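/- \textbf{Conventions.} A norming function is a map $\Phi$ from the finitely supported real sequences $\xi=(\xi_j)_{j\ge 1}$ to $\mathbb R$ that is a norm, satisfies $\Phi((1,0,0,\dots))=1$, and is invariant under permutations of the indices. $\mathcal H$ denotes a separable infinite-dimensional complex Hilbert space. For a finite rank operator $T$ on $\mathcal H$ put $|T|_\Phi=\Phi((s_j(T))_{j})$, where the $s_j(T)$ are the eigenvalues of $(T^*T)^{1/2}$, repeated according to multiplicity. For an $n$-tuple $\varphi=(\varphi(1),\dots,\varphi(n))$ of norming functions and an $n$-tuple $\tau=(\tau(1),\dots,\tau(n))$ of bounded operators on $\mathcal H$ put $\|\tau\|=\max_j\|\tau(j)\|$ and \[ k_\varphi(\tau)=\liminf_{A}\ \max_{1\le j\le n}\bigl|[\tau(j),A]\bigr|_{\varphi(j)}\in[0,\infty], \] the $\liminf$ being over the upward directed set of finite rank positive contractions $A$ on $\mathcal H$. A vector $\xi$ is cyclic for $\tau$ if $\mathcal A\xi$ is dense in $\mathcal H$, where $\mathcal A$ is the unital algebra generated by $\tau(1),\dots,\tau(n)$. \textbf{Proposition.} Let $\varphi$ be an $n$-tuple of norming functions. (a)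 Suppose that $\varphi(k)(\underbrace{1,\dots,1}_{m},0,\dots)\to\infty$ as $m\to\infty$ for every $1\le k\le n$, and that \[ \lim_{m\to\infty} m^{-1}\prod_{k=1}^n\varphi(k)(\underbrace{1,\dots,1}_{m},0,\dots)=B,\qquad 0<B<\infty . \] Then there is a constant $C$, depending only on $\varphi$, such that $k_\varphi(\tau)\le C\|\tau\|$ for every $n$-tuple $\tau$ of commuting hermitian operators on $\mathcal H$ that has a cyclic vector. (b) Suppose that there is a constant $C$ such that $k_\varphi(\tau)\le C\|\tau\|$ for every $n$-tuple $\tau$ of commuting hermitian operators on $\mathcal H$ that has a cyclic vector. Then $k_\varphi(\tau)=0$ for every $n$-tuple $\tau$ of commuting hermitian operators on $\mathcal H$ whose (joint, projection-valued) spectral measure on $\mathbb R^n$ is singular with respect to $n$-dimensional Lebesgue measure. -/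

import Mathlib

open Filter Topology MeasureTheory
open scoped NNReal ENNReal InnerProductSpace

universe u

/-- A norming function on the space of finitely supported real sequences: a norm, normalized on the
first unit sequence and invariant under all permutations of the index set. -/
structure NormingFunction where
  /-- The value of the norming function on a finitely supported sequence. -/
  toFun : (ℕ →₀ ℝ) → ℝ
  pos_of_ne_zero : ∀ ξ, ξ ≠ 0 → 0 < toFun ξ
  map_smul : ∀ (α : ℝ) ξ, toFun (α • ξ) = |α| * toFun ξ
  add_le : ∀ ξ η, toFun (ξ + η) ≤ toFun ξ + toFun η
  map_single : toFun (Finsupp.single 0 1) = 1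
  map_perm : ∀ (π : Equiv.Perm ℕ) ξ, toFun (ξ.equivMapDomain π) = toFun ξ

instance : CoeFun NormingFunction (fun _ => (ℕ →₀ ℝ) → ℝ) := ⟨NormingFunction.toFun⟩

/-- The sequence `(1, …, 1, 0, 0, …)` with `m` ones. -/
noncomputable def onesSeq (m : ℕ) : ℕ →₀ ℝ :=
  Finsupp.indicator (Finset.range m) (fun _ _ => 1)

section Operators

variable {H : Type u} [NormedAddCommGroup H] [InnerProductSpace ℂ H]

open Classical in
/-- The singular values (in decreasing order, repeated according to multiplicity, followed by
zeros) of a finite rank operator `T`, obtained from the restriction of `T` to a map between the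
finite dimensional spaces `(ker T)ᗮ` and `T ((ker T)ᗮ) = range T`. They are the nonzero
eigenvalues of `(T* T)^(1/2)`. The value `0` for operators that are not of finite rank is never
used. -/
noncomputable def singularSeq (T : H →L[ℂ] H) : ℕ →₀ ℝ :=
  if h : FiniteDimensional ℂ (LinearMap.ker (T : H →ₗ[ℂ] H))ᗮ then
    haveI := h
    ((T : H →ₗ[ℂ] H) ∘ₗ (LinearMap.ker (T : H →ₗ[ℂ] H))ᗮ.subtype).rangeRestrict.singularValues
  else 0

/-- `|T|_Φ` for a finite rank operator `T`: the norming function applied to the singular values. -/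
noncomputable def finiteRankNorm (Φ : NormingFunction) (T : H →L[ℂ] H) : ℝ≥0∞ :=
  ENNReal.ofReal (Φ (singularSeq T))

variable (H) in
/-- The finite rank positive contractions on `H`, with the order of hermitian operators
(`A ≤ B` iff `B - A` is positive). -/
abbrev FiniteRankPosContraction : Type u :=
  {A : H →L[ℂ] H // 0 ≤ A ∧ ‖A‖ ≤ 1 ∧ FiniteDimensional ℂ (LinearMap.range (A : H →ₗ[ℂ] H))}

/-- The modulus of quasicentral approximation
`k_φ(τ) = liminf_A max_j |[τ(j), A]|_{φ(j)}`, the `liminf` being taken along the upward directed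
set of finite rank positive contractions; it takes values in `[0, ∞]`. -/
noncomputable def quasicentralModulus {n : ℕ} (φ : Fin n → NormingFunction)
    (τ : Fin n → H →L[ℂ] H) : ℝ≥0∞ :=
  liminf (fun A : FiniteRankPosContraction H =>
    ⨆ j, finiteRankNorm (φ j) (τ j * A.1 - A.1 * τ j)) atTop

/-- `ξ` is cyclic for `τ`: the vectors `a ξ`, for `a` in the unital algebra generated
by the components of `τ`, are dense in `H`. -/
def IsCyclicVector {n : ℕ} (τ : Fin n → H →L[ℂ] H) (ξ : H) : Prop :=
  Dense {v : H | ∃ a ∈ Algebra.adjoin ℂ (Set.range τ), a ξ = v}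

variable [CompleteSpace H]

/-- An `n`-tuple of commuting hermitian operators. -/
structure IsCommutingHermitian {n : ℕ} (τ : Fin n → H →L[ℂ] H) : Prop where
  isSelfAdjoint : ∀ j, IsSelfAdjoint (τ j)
  commute : ∀ i j, Commute (τ i) (τ j)

variable (H) in
/-- A projection-valued measure on the Borel sets of `ℝⁿ`, countably additive in the strong
operator topology. Only its values on measurable sets matter. -/
structure ProjectionMeasure (n : ℕ) where
  /-- The projection attached to a set. -/
  proj : Set (Fin n → ℝ) → H →L[ℂ] H
  isStarProjection : ∀ s, MeasurableSet s → IsStarProjection (proj s)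
  proj_empty : proj ∅ = 0
  proj_univ : proj Set.univ = 1
  proj_inter : ∀ s t, MeasurableSet s → MeasurableSet t → proj (s ∩ t) = proj s * proj t
  hasSum_proj : ∀ f : ℕ → Set (Fin n → ℝ), (∀ i, MeasurableSet (f i)) →
    Pairwise (Function.onFun Disjoint f) → ∀ x, HasSum (fun i => proj (f i) x) (proj (⋃ i, f i) x)

namespace ProjectionMeasure

variable {n : ℕ} (E : ProjectionMeasure H n)

theorem re_inner_proj_nonneg (s : Set (Fin n → ℝ)) (hs : MeasurableSet s) (x : H) :
    0 ≤ (⟪x, E.proj s x⟫_ℂ).re := by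
  have h : 0 ≤ E.proj s := (E.isStarProjection s hs).nonneg
  have h2 := ((ContinuousLinearMap.nonneg_iff_isPositive _).1 h).re_inner_nonneg_right x
  simpa using h2

/-- The scalar measure `s ↦ ⟨x, E(s) x⟩ = ‖E(s) x‖²` attached to a vector `x`. -/
noncomputable def scalarMeasure (x : H) : Measure (Fin n → ℝ) :=
  Measure.ofMeasurable (fun s _ => ENNReal.ofReal (⟪x, E.proj s x⟫_ℂ).re)
    (by simp [E.proj_empty])
    (by
      intro f hf hd
      have h1 := E.hasSum_proj f hf hd x
      have h2 : HasSum (fun i => (⟪x, E.proj (f i) x⟫_ℂ).re)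
          (⟪x, E.proj (⋃ i, f i) x⟫_ℂ).re :=
        Complex.hasSum_re (h1.mapL (innerSL ℂ x))
      rw [← h2.tsum_eq]
      exact ENNReal.ofReal_tsum_of_nonneg
        (fun i => E.re_inner_proj_nonneg _ (hf i) x) h2.summable)

/-- `E` is the (joint) spectral measure of `τ`: it has compact support and
`τ(j) = ∫ y_j dE(y)` (weakly) for every `j`. -/
structure IsSpectralMeasureOf (τ : Fin n → H →L[ℂ] H) : Prop where
  compact_support : ∃ K : Set (Fin n → ℝ), IsCompact K ∧ E.proj Kᶜ = 0
  integral_coord : ∀ j x, ((∫ y, y j ∂(E.scalarMeasure x) : ℝ) : ℂ) = ⟪x, τ j x⟫_ℂ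

/-- `E` is singular with respect to `n`-dimensional Lebesgue measure: it is concentrated on a
Lebesgue null set. -/
def IsLebesgueSingular : Prop :=
  ∃ N : Set (Fin n → ℝ), MeasurableSet N ∧ volume N = 0 ∧ E.proj Nᶜ = 0

end ProjectionMeasure

end Operators

/-- The bound `k_φ(τ) ≤ C ‖τ‖` for all `n`-tuples `τ` of commuting hermitian operators with a cyclic
vector on separable infinite dimensional complex Hilbert spaces, where `‖τ‖ = max_j ‖τ(j)‖`. -/
def HasCyclicBound {n : ℕ} (φ : Fin n → NormingFunction) (C : ℝ≥0) : Prop :=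
  ∀ (H : Type u) [NormedAddCommGroup H] [InnerProductSpace ℂ H] [CompleteSpace H]
    [TopologicalSpace.SeparableSpace H], ¬ FiniteDimensional ℂ H →
    ∀ τ : Fin n → H →L[ℂ] H, IsCommutingHermitian τ → (∃ ξ, IsCyclicVector τ ξ) →
      quasicentralModulus φ τ ≤ ENNReal.ofReal (C * ‖τ‖)

/-! Part (a) is a counting argument. Cut the spectrum of each `τ k` into `N k` pieces of length `2 *
‖τ‖ / N k`. The joint spectral pieces of a cyclic vector `ξ` span a space `V` of dimension at most
`∏ k, N k`, invariant under step-function approximants of the `τ k`. Cyclicity makes `V` nearly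
contain any given finite set once the mesh is small. The commutator of `τ k` with the projection
onto `V` has norm at most `4 * ‖τ‖ / N k` and rank at most twice `dim V`. Taking `N k` to be `φ k
(onesSeq m)` rounded up, the limit hypothesis makes `dim V` at most a constant times `m`. The ideal
norm of the commutator is then at most a constant times `‖τ‖ / φ k (onesSeq m) * φ k (onesSeq m)`,
which does not depend on `m` (`exists_projection_of_cyclic`, `hasCyclicBound_of_tendsto`).

Part (b) is a rearrangement argument. Up to a small error, a vector `v` is carried by at most `(η *
p) ^ n` cubes of side `1 / p`, because the spectral measure lives on a null set (`exists_cubes`).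
Translate these cubes to separated places of a grid near the origin. On each cube the new tuple `X`
differs from `τ` by scalars, so block diagonal operators have the same commutators with both
(`commutator_pinch`), while `‖X‖ ≤ 5 * η`. The assumed bound, applied on a cyclic subspace of `X`,
gives commutators of size `O(η)`. Separation makes each block projection a spectral projection of
`X` (`commute_proj_block`), so the cyclic subspace contains the components of the vector in all
blocks, and the operator obtained still fixes the vector after restriction to its block diagonal.

Norming functions are not assumed invariant under sign changes. Monotonicity, the triangle
inequality and the ideal property of `gauge` are therefore proved only up to constants (3 and 9),
which is harmless for both parts. -/

set_option linter.unusedSectionVars false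

/-! ### Permutation-invariant norms and substochastic matrices -/

namespace NormingFunction

variable (Φ : NormingFunction)

theorem map_zero' : Φ 0 = 0 := by
  have := Φ.map_smul 0 0
  simpa using this

theorem nonneg (ξ : ℕ →₀ ℝ) : 0 ≤ Φ ξ := by
  by_cases h : ξ = 0
  · rw [h, Φ.map_zero']
  · exact (Φ.pos_of_ne_zero ξ h).le

/-- The finitely supported sequence with entries `x i` at the places `e i`. -/
noncomputable def place {ι : Type*} [Fintype ι] (e : ι → ℕ) (x : ι → ℝ) : ℕ →₀ ℝ :=
  ∑ i, Finsupp.single (e i) (x i)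

/-- The permutations of `ℕ` act multiply transitively, so one of them carries the places `e` to the
places `e'`. -/
theorem map_place_eq {ι : Type*} [Fintype ι] {e e' : ι → ℕ} (he : Function.Injective e)
    (he' : Function.Injective e') (x : ι → ℝ) : Φ (place e x) = Φ (place e' x) := by
  have := (Equiv.Perm.isMultiplyPretransitive ℕ (Fintype.card ι)).exists_smul_eq
  obtain ⟨g, hg⟩ := this (Equiv.toEmbedding (Fintype.equivFin ι).symm |>.trans ⟨e, he⟩)
    (Equiv.toEmbedding (Fintype.equivFin ι).symm |>.trans ⟨e', he'⟩)
  have hg' : ∀ i, g (e i) = e' i := by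
    intro i
    have := DFunLike.congr_fun hg (Fintype.equivFin ι i)
    simpa using this
  rw [← Φ.map_perm g (place e x)]
  congr 1
  rw [Finsupp.equivMapDomain_eq_mapDomain, place, place, Finsupp.mapDomain_finsetSum]
  simp [Finsupp.mapDomain_single, hg']

/-- A norming function evaluated on a finite family of reals. -/
noncomputable def on {ι : Type*} [Fintype ι] (x : ι → ℝ) : ℝ :=
  Φ (place (fun i => (Fintype.equivFin ι i : ℕ)) x)

section On

variable {ι κ : Type*} [Fintype ι] [Fintype κ]

theorem on_eq {e : ι → ℕ} (he : Function.Injective e) (x : ι → ℝ) : Φ.on x = Φ (place e x) :=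
  Φ.map_place_eq (Fin.val_injective.comp (Fintype.equivFin ι).injective) he x

theorem on_nonneg (x : ι → ℝ) : 0 ≤ Φ.on x := Φ.nonneg _

theorem on_add (x y : ι → ℝ) : Φ.on (x + y) ≤ Φ.on x + Φ.on y := by
  unfold on
  refine le_trans (le_of_eq ?_) (Φ.add_le _ _)
  simp [place, Finset.sum_add_distrib]

theorem on_smul (c : ℝ) (x : ι → ℝ) : Φ.on (c • x) = |c| * Φ.on x := by
  unfold on
  rw [← Φ.map_smul]
  simp [place, Finset.smul_sum]

theorem on_zero : Φ.on (0 : ι → ℝ) = 0 := by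
  simp [on, place, Φ.map_zero']

theorem on_sum {α : Type*} (s : Finset α) (x : α → ι → ℝ) :
    Φ.on (∑ a ∈ s, x a) ≤ ∑ a ∈ s, Φ.on (x a) := by
  classical
  induction s using Finset.induction_on with
  | empty => simp [on_zero]
  | insert a s ha ih =>
    rw [Finset.sum_insert ha, Finset.sum_insert ha]
    exact (Φ.on_add _ _).trans (by gcongr)

/-- Invariance of a norming function under reindexing and deletion of zeros. -/
theorem on_comp {f : ι → κ} (hf : Function.Injective f) (y : κ → ℝ)
    (hy : ∀ k, k ∉ Set.range f → y k = 0) : Φ.on (y ∘ f) = Φ.on y := by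
  have h1 : Function.Injective (fun k => (Fintype.equivFin κ k : ℕ)) :=
    Fin.val_injective.comp (Fintype.equivFin κ).injective
  rw [Φ.on_eq (h1.comp hf), Φ.on_eq h1]
  congr 1
  classical
  unfold place
  rw [← Finset.sum_subset (Finset.subset_univ (Finset.univ.image f))]
  · rw [Finset.sum_image (fun a _ b _ h => hf h)]
    rfl
  · intro k _ hk
    rw [hy k (by simpa using hk), Finsupp.single_zero]

theorem on_perm (σ : Equiv.Perm ι) (x : ι → ℝ) : Φ.on (x ∘ σ) = Φ.on x :=
  Φ.on_comp σ.injective x (fun k hk => absurd (σ.surjective k) hk)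

/-- Birkhoff: doubly stochastic averaging does not increase a norming function. -/
theorem on_mulVec_le [DecidableEq ι] {S : Matrix ι ι ℝ} (hS : S ∈ doublyStochastic ℝ ι)
    (x : ι → ℝ) : Φ.on (S.mulVec x) ≤ Φ.on x := by
  obtain ⟨w, hw, hw1, rfl⟩ := exists_eq_sum_perm_of_mem_doublyStochastic hS
  have : (∑ σ : Equiv.Perm ι, w σ • σ.permMatrix ℝ).mulVec x
      = ∑ σ : Equiv.Perm ι, w σ • (x ∘ σ) := by
    rw [Matrix.sum_mulVec]
    refine Finset.sum_congr rfl fun σ _ => ?_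
    rw [Matrix.smul_mulVec, Matrix.permMatrix_mulVec]
  rw [this]
  calc _ ≤ ∑ σ : Equiv.Perm ι, Φ.on (w σ • (x ∘ σ)) := Φ.on_sum _ _
    _ = ∑ σ : Equiv.Perm ι, w σ * Φ.on x := by
      refine Finset.sum_congr rfl fun σ _ => ?_
      rw [on_smul, on_perm, abs_of_nonneg (hw σ)]
    _ = Φ.on x := by rw [← Finset.sum_mul, hw1, one_mul]

/-- The symmetrization of a norming function, which is invariant under sign changes. -/
noncomputable def sym (x : ι → ℝ) : ℝ := Φ.on (Sum.elim x (-x))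

theorem sym_le (x : ι → ℝ) : Φ.sym x ≤ 2 * Φ.on x := by
  have h : (Sum.elim x (-x) : ι ⊕ ι → ℝ) = Sum.elim x 0 + (-1 : ℝ) • (Sum.elim 0 x : ι ⊕ ι → ℝ) := by
    ext i; cases i <;> simp
  have h1 : Φ.on (Sum.elim x 0 : ι ⊕ ι → ℝ) = Φ.on x :=
    (Φ.on_comp Sum.inl_injective (Sum.elim x 0 : ι ⊕ ι → ℝ) (by
      rintro (k | k) hk <;> simp_all)).symm
  have h2 : Φ.on (Sum.elim 0 x : ι ⊕ ι → ℝ) = Φ.on x :=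
    (Φ.on_comp Sum.inr_injective (Sum.elim 0 x : ι ⊕ ι → ℝ) (by
      rintro (k | k) hk <;> simp_all)).symm
  rw [sym, h]
  refine (Φ.on_add _ _).trans ?_
  rw [on_smul, h1, h2]
  norm_num
  linarith

/-- The doubly stochastic matrix with all entries equal replaces `x` by the constant vector of its
mean. -/
theorem sum_mul_on_one_le [Nonempty ι] (x : ι → ℝ) (hx : ∀ i, 0 ≤ x i) :
    (∑ i, x i) / Fintype.card ι * Φ.on (1 : ι → ℝ) ≤ Φ.on x := by
  classical
  have hc : (0 : ℝ) < Fintype.card ι := by exact_mod_cast Fintype.card_pos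
  have hS : (Matrix.of fun _ _ => (Fintype.card ι : ℝ)⁻¹ : Matrix ι ι ℝ)
      ∈ doublyStochastic ℝ ι := by
    rw [mem_doublyStochastic_iff_sum]
    refine ⟨fun i j => by simp, fun i => ?_, fun j => ?_⟩ <;> simp
  refine le_trans (le_of_eq ?_) (Φ.on_mulVec_le hS x)
  have : (Matrix.of fun _ _ => (Fintype.card ι : ℝ)⁻¹ : Matrix ι ι ℝ).mulVec x
      = ((∑ i, x i) / Fintype.card ι) • (1 : ι → ℝ) := by
    ext i
    simp [Matrix.mulVec, dotProduct, ← Finset.mul_sum, div_eq_inv_mul]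
  rw [this, on_smul, abs_of_nonneg (div_nonneg (Finset.sum_nonneg fun i _ => hx i) hc.le)]

/-- This recovers `Φ` from its symmetrization. Pad `x` with an `ι × ι` block of zeros. The vectors
`z k` carry `-x` in column `k` of the block, so their average has `-x i / M` throughout row `i`.
Adding `x i / M` times the indicator `w i` of that row restores the zeros. Each `z k` has norm `sym
x`, and each `w i` has the norm of the constant vector `1`. -/
theorem on_le_sym_add [Nonempty ι] (x : ι → ℝ) (hx : ∀ i, 0 ≤ x i) :
    Φ.on x ≤ Φ.sym x + (∑ i, x i) / Fintype.card ι * Φ.on (1 : ι → ℝ) := by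
  classical
  have hc : (0 : ℝ) < Fintype.card ι := by exact_mod_cast Fintype.card_pos
  set M : ℝ := (Fintype.card ι : ℝ)
  let z : ι → (ι ⊕ ι × ι → ℝ) := fun k =>
    Sum.elim x (fun p => if p.2 = k then - x p.1 else 0)
  let w : ι → (ι ⊕ ι × ι → ℝ) := fun i => Sum.elim 0 (fun p => if p.1 = i then 1 else 0)
  have hz : ∀ k, Φ.on (z k) = Φ.sym x := by
    intro k
    have hf : Function.Injective (Sum.map id (fun i => (i, k)) : ι ⊕ ι → ι ⊕ ι × ι) :=
      Sum.map_injective.2 ⟨Function.injective_id, fun a b h => (Prod.mk.inj h).1⟩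
    rw [← Φ.on_comp hf (z k)]
    · unfold sym; congr 1; ext i; cases i <;> simp [z]
    · rintro (j | ⟨j, l⟩) hk
      · simp at hk
      · have : l ≠ k := by rintro rfl; simp at hk
        simp [z, this]
  have hw : ∀ i, Φ.on (w i) = Φ.on (1 : ι → ℝ) := by
    intro i
    have hf : Function.Injective (fun l => Sum.inr (i, l) : ι → ι ⊕ ι × ι) := by
      intro a b h; simpa using h
    rw [← Φ.on_comp hf (w i)]
    · congr 1; ext l; simp [w]
    · rintro (j | ⟨j, l⟩) hk
      · simp [w]
      · have : j ≠ i := by rintro rfl; simp at hk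
        simp [w, this]
  have hx0 : Φ.on x = Φ.on (Sum.elim x 0 : ι ⊕ ι × ι → ℝ) :=
    Φ.on_comp Sum.inl_injective (Sum.elim x 0 : ι ⊕ ι × ι → ℝ) (by
      rintro (k | k) hk <;> simp_all)
  have hdec : (Sum.elim x 0 : ι ⊕ ι × ι → ℝ)
      = ∑ k, M⁻¹ • z k + ∑ i, (x i / M) • w i := by
    ext i
    rcases i with i | ⟨i, l⟩
    · simp [z, w, Finset.sum_apply, M]
    · simp [z, w, Finset.sum_apply]
      field_simp
      simp
  rw [hx0, hdec]
  refine (Φ.on_add _ _).trans (add_le_add ?_ ?_)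
  · refine (Φ.on_sum _ _).trans (le_of_eq ?_)
    simp only [on_smul, hz]
    simp [M]
  · refine (Φ.on_sum _ _).trans (le_of_eq ?_)
    simp only [on_smul, hw]
    rw [← Finset.sum_mul, Finset.sum_div]
    congr 1
    exact Finset.sum_congr rfl fun i _ => abs_of_nonneg (div_nonneg (hx i) hc.le)

/-- Square matrices with nonnegative entries whose rows and columns have sum at most `1`. -/
structure IsSubstochastic (D : Matrix ι ι ℝ) : Prop where
  nonneg : ∀ i j, 0 ≤ D i j
  row : ∀ i, ∑ j, D i j ≤ 1
  col : ∀ j, ∑ i, D i j ≤ 1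

/-- The row deficits `r` and column deficits `c` have the same total, so the rank one matrix `r i *
c j / ∑ r` fills up both. It is handed over as two halves because `sym_mulVec_le` distributes it
over diagonal and off-diagonal blocks. -/
theorem IsSubstochastic.exists_doublyStochastic [DecidableEq ι] {D : Matrix ι ι ℝ}
    (hD : IsSubstochastic D) :
    ∃ U : Matrix ι ι ℝ, (∀ i j, 0 ≤ U i j) ∧ D + (2 : ℝ) • U ∈ doublyStochastic ℝ ι := by
  set r : ι → ℝ := fun i => 1 - ∑ j, D i j
  set c : ι → ℝ := fun j => 1 - ∑ i, D i j
  have hr : ∀ i, 0 ≤ r i := fun i => sub_nonneg.2 (hD.row i)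
  have hc : ∀ j, 0 ≤ c j := fun j => sub_nonneg.2 (hD.col j)
  have hrc : ∑ i, r i = ∑ j, c j := by
    simp only [r, c, Finset.sum_sub_distrib]
    rw [Finset.sum_comm]
  -- This covers total deficit zero: the quotient is then zero by convention, and so is every
  -- deficit.
  have h0 : ∀ f : ι → ℝ, (∀ i, 0 ≤ f i) → ∀ i, f i = f i * (∑ j, f j) / (∑ j, f j) := by
    intro f hf i
    by_cases hs : ∑ j, f j = 0
    · have := (Finset.sum_eq_zero_iff_of_nonneg fun i _ => hf i).1 hs i (Finset.mem_univ i)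
      simp [this]
    · field_simp
  refine ⟨Matrix.of fun i j => r i * c j / (2 * ∑ i, r i), fun i j => ?_, ?_⟩
  · have := Finset.sum_nonneg fun i (_ : i ∈ Finset.univ) => hr i
    have := hr i
    have := hc j
    simp only [Matrix.of_apply]
    positivity
  rw [mem_doublyStochastic_iff_sum]
  have key : ∀ i j, (D + (2 : ℝ) • (Matrix.of fun i j => r i * c j / (2 * ∑ i, r i))) i j
      = D i j + r i * c j / ∑ i, r i := by
    intro i j
    simp only [Matrix.add_apply, Matrix.smul_apply, Matrix.of_apply, smul_eq_mul]
    congr 1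
    rw [mul_div_assoc', mul_div_mul_left _ _ two_ne_zero]
  refine ⟨fun i j => ?_, fun i => ?_, fun j => ?_⟩
  · rw [key]
    have := Finset.sum_nonneg fun i (_ : i ∈ Finset.univ) => hr i
    have := hr i
    have := hc j
    have := hD.nonneg i j
    positivity
  · simp only [key, Finset.sum_add_distrib]
    rw [← Finset.sum_div, ← Finset.mul_sum, ← hrc, ← h0 r hr i]
    simp [r]
  · simp only [key, Finset.sum_add_distrib]
    rw [← Finset.sum_div, ← Finset.sum_mul, mul_comm, hrc, ← h0 c hc j]
    simp [c]

/-- The block matrix with `D + U` on the diagonal and `U` off it is doubly stochastic. On `(x, -x)`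
the contributions of `U` cancel, leaving `(D x, -D x)`. -/
theorem sym_mulVec_le {D : Matrix ι ι ℝ} (hD : IsSubstochastic D) (x : ι → ℝ) :
    Φ.sym (D.mulVec x) ≤ Φ.sym x := by
  classical
  obtain ⟨U, hU, hS⟩ := hD.exists_doublyStochastic
  rw [mem_doublyStochastic_iff_sum] at hS
  have hT : Matrix.fromBlocks (D + U) U U (D + U) ∈ doublyStochastic ℝ (ι ⊕ ι) := by
    rw [mem_doublyStochastic_iff_sum]
    refine ⟨?_, ?_, ?_⟩
    · rintro (i | i) (j | j) <;> simp [hU, add_nonneg, hD.nonneg]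
    · rintro (i | i) <;>
      · rw [← hS.2.1 i]
        simp [two_mul, Finset.sum_add_distrib]
        ring
    · rintro (i | i) <;>
      · rw [← hS.2.2 i]
        simp [two_mul, Finset.sum_add_distrib]
        ring
  have := Φ.on_mulVec_le hT (Sum.elim x (-x))
  rw [Matrix.fromBlocks_mulVec] at this
  refine le_trans (le_of_eq ?_) this
  unfold sym
  congr 1
  simp [Matrix.add_mulVec, Matrix.mulVec_neg]

/-- Of the factor 3, two come from comparing `sym` with `Φ` and one from the mean, which `D` does
not increase on nonnegative vectors. -/
theorem on_substochastic_le {D : Matrix ι ι ℝ} (hD : IsSubstochastic D) {x : ι → ℝ}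
    (hx : ∀ i, 0 ≤ x i) : Φ.on (D.mulVec x) ≤ 3 * Φ.on x := by
  rcases isEmpty_or_nonempty ι with h | h
  · have : D.mulVec x = 0 := Subsingleton.elim _ _
    rw [this, on_zero]
    exact mul_nonneg (by norm_num) (Φ.on_nonneg x)
  have hDx : ∀ i, 0 ≤ D.mulVec x i := fun i =>
    Finset.sum_nonneg fun j _ => mul_nonneg (hD.nonneg i j) (hx j)
  have hc : (0 : ℝ) < Fintype.card ι := by exact_mod_cast Fintype.card_pos
  have hsum : ∑ i, D.mulVec x i ≤ ∑ i, x i := by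
    simp only [Matrix.mulVec, dotProduct]
    rw [Finset.sum_comm]
    refine Finset.sum_le_sum fun j _ => ?_
    rw [← Finset.sum_mul]
    exact mul_le_of_le_one_left (hx j) (hD.col j)
  have h1 := Φ.on_le_sym_add _ hDx
  have h2 := Φ.sym_mulVec_le hD x
  have h3 := Φ.sym_le x
  have h4 := Φ.sum_mul_on_one_le x hx
  have h5 : (∑ i, D.mulVec x i) / Fintype.card ι * Φ.on (1 : ι → ℝ)
      ≤ (∑ i, x i) / Fintype.card ι * Φ.on (1 : ι → ℝ) := by
    gcongr
    exact Φ.on_nonneg _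
  linarith

/-- The diagonal matrix of the ratios `x i / y i` is substochastic and maps `y` to `x`. -/
theorem on_le_of_le {x y : ι → ℝ} (hx : ∀ i, 0 ≤ x i) (hxy : ∀ i, x i ≤ y i) :
    Φ.on x ≤ 3 * Φ.on y := by
  classical
  have hD : IsSubstochastic (Matrix.diagonal fun i => x i / y i) := by
    have h0 : ∀ i, 0 ≤ x i / y i := fun i => div_nonneg (hx i) ((hx i).trans (hxy i))
    have h1 : ∀ i, x i / y i ≤ 1 := fun i => div_le_one_of_le₀ (hxy i) ((hx i).trans (hxy i))
    refine ⟨fun i j => ?_, fun i => ?_, fun j => ?_⟩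
    · by_cases h : i = j <;> simp [Matrix.diagonal, h, h0]
    · simpa [Matrix.diagonal] using h1 i
    · simpa [Matrix.diagonal] using h1 j
  convert Φ.on_substochastic_le hD (fun i => (hx i).trans (hxy i)) using 2
  ext i
  rw [Matrix.mulVec_diagonal]
  by_cases h : y i = 0
  · have := hxy i; have := hx i
    simp [h]; linarith
  · field_simp

end On

theorem eq_on (ξ : ℕ →₀ ℝ) {M : ℕ} (h : ∀ k, M ≤ k → ξ k = 0) :
    Φ ξ = Φ.on (fun k : Fin M => ξ k) := by
  rw [Φ.on_eq Fin.val_injective]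
  congr 1
  ext k
  simp only [place, Finsupp.coe_finsetSum, Finset.sum_apply, Finsupp.single_apply]
  by_cases hk : k < M
  · rw [Finset.sum_eq_single ⟨k, hk⟩]
    · simp
    · intro b _ hb
      rw [if_neg]
      intro h; apply hb; ext; exact h
    · simp
  · rw [h k (by omega), Finset.sum_eq_zero]
    intro b _
    rw [if_neg]
    have := b.2
    omega

theorem onesSeq_eq_on (m : ℕ) : Φ (onesSeq m) = Φ.on (1 : Fin m → ℝ) := by
  rw [Φ.eq_on (onesSeq m) (M := m)]
  · congr 1
    ext k
    simp [onesSeq, Finsupp.indicator_apply]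
  · intro k hk
    simp [onesSeq, Finsupp.indicator_apply]
    omega

theorem onesSeq_mul_le (c m : ℕ) : Φ (onesSeq (c * m)) ≤ c * Φ (onesSeq m) := by
  classical
  rw [onesSeq_eq_on, onesSeq_eq_on]
  let e : Fin c × Fin m ≃ Fin (c * m) := finProdFinEquiv
  rw [← Φ.on_comp e.injective 1 (fun k hk => absurd (e.surjective k) hk)]
  let w : Fin c → (Fin c × Fin m → ℝ) := fun i p => if p.1 = i then 1 else 0
  have hw : ∀ i, Φ.on (w i) = Φ.on (1 : Fin m → ℝ) := by
    intro i
    have hf : Function.Injective (fun l => (i, l) : Fin m → Fin c × Fin m) := by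
      intro a b h; simpa using h
    rw [← Φ.on_comp hf (w i)]
    · congr 1; ext l; simp [w]
    · rintro ⟨j, l⟩ hk
      have : j ≠ i := by rintro rfl; simp at hk
      simp [w, this]
  have : ((1 : Fin (c * m) → ℝ) ∘ e) = ∑ i, w i := by
    ext p
    simp [w, Finset.sum_apply]
  rw [this]
  refine (Φ.on_sum _ _).trans (le_of_eq ?_)
  simp [hw]

theorem onesSeq_le {l m : ℕ} (h : l ≤ m) : Φ (onesSeq l) ≤ 3 * Φ (onesSeq m) := by
  rw [Φ.eq_on (onesSeq l) (M := m), Φ.eq_on (onesSeq m) (M := m)]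
  · refine Φ.on_le_of_le (fun i => ?_) (fun i => ?_) <;>
    · simp only [onesSeq, Finsupp.indicator_apply, Finset.mem_range]
      split_ifs
      all_goals first | norm_num; done | omega
  all_goals
    intro k hk
    simp only [onesSeq, Finsupp.indicator_apply, Finset.mem_range]
    split_ifs <;> first | rfl | omega

end NormingFunction

/-! ### Singular values and quasi-norm properties of the gauge -/

section FiniteRank

variable {H H' H'' : Type*} [NormedAddCommGroup H] [InnerProductSpace ℂ H]
  [NormedAddCommGroup H'] [InnerProductSpace ℂ H'] [NormedAddCommGroup H'']
  [InnerProductSpace ℂ H'']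

/-- Continuous linear maps with finite dimensional range. -/
def IsFiniteRank (T : H →L[ℂ] H') : Prop :=
  FiniteDimensional ℂ (LinearMap.range (T : H →ₗ[ℂ] H'))

theorem IsFiniteRank.of_range_le {T : H →L[ℂ] H'} (V : Submodule ℂ H') [FiniteDimensional ℂ V]
    (h : ∀ x, T x ∈ V) : IsFiniteRank T :=
  Submodule.finiteDimensional_of_le (S₂ := V) (by rintro _ ⟨x, rfl⟩; exact h x)

theorem IsFiniteRank.zero : IsFiniteRank (0 : H →L[ℂ] H') :=
  .of_range_le ⊥ (by simp)

theorem IsFiniteRank.add {S T : H →L[ℂ] H'} (hS : IsFiniteRank S) (hT : IsFiniteRank T) :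
    IsFiniteRank (S + T) := by
  have h1 := hS
  have h2 := hT
  unfold IsFiniteRank at h1 h2
  refine .of_range_le (LinearMap.range (S : H →ₗ[ℂ] H') ⊔ LinearMap.range (T : H →ₗ[ℂ] H'))
    fun x => ?_
  exact Submodule.add_mem_sup ⟨x, rfl⟩ ⟨x, rfl⟩

theorem IsFiniteRank.comp_left {T : H →L[ℂ] H'} (hT : IsFiniteRank T) (X : H' →L[ℂ] H'') :
    IsFiniteRank (X ∘L T) := by
  have := hT
  unfold IsFiniteRank at this
  refine .of_range_le ((LinearMap.range (T : H →ₗ[ℂ] H')).map (X : H' →ₗ[ℂ] H'')) fun x => ?_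
  exact ⟨T x, ⟨x, rfl⟩, rfl⟩

theorem IsFiniteRank.comp_right {T : H →L[ℂ] H'} (hT : IsFiniteRank T) (Y : H'' →L[ℂ] H) :
    IsFiniteRank (T ∘L Y) := by
  have := hT
  unfold IsFiniteRank at this
  exact .of_range_le (LinearMap.range (T : H →ₗ[ℂ] H')) fun x => ⟨Y x, rfl⟩

theorem IsFiniteRank.mul_left {T : H →L[ℂ] H} (hT : IsFiniteRank T) (X : H →L[ℂ] H) :
    IsFiniteRank (X * T) := hT.comp_left X

theorem IsFiniteRank.mul_right {T : H →L[ℂ] H} (hT : IsFiniteRank T) (Y : H →L[ℂ] H) :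
    IsFiniteRank (T * Y) := hT.comp_right Y

theorem IsFiniteRank.neg {T : H →L[ℂ] H'} (hT : IsFiniteRank T) : IsFiniteRank (-T) := by
  have := hT
  unfold IsFiniteRank at this
  exact .of_range_le (LinearMap.range (T : H →ₗ[ℂ] H')) fun x => ⟨-x, by simp⟩

theorem IsFiniteRank.sub {S T : H →L[ℂ] H'} (hS : IsFiniteRank S) (hT : IsFiniteRank T) :
    IsFiniteRank (S - T) := by
  rw [sub_eq_add_neg]
  exact hS.add hT.neg

theorem IsFiniteRank.sum {α : Type*} {s : Finset α} {T : α → H →L[ℂ] H'}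
    (h : ∀ a ∈ s, IsFiniteRank (T a)) : IsFiniteRank (∑ a ∈ s, T a) := by
  classical
  induction s using Finset.induction_on with
  | empty => simpa using IsFiniteRank.zero
  | insert a s ha ih =>
    rw [Finset.sum_insert ha]
    exact (h a (by simp)).add (ih fun b hb => h b (by simp [hb]))

theorem IsFiniteRank.commutator {A : H →L[ℂ] H} (hA : IsFiniteRank A) (T : H →L[ℂ] H) :
    IsFiniteRank (T * A - A * T) := (hA.mul_left T).sub (hA.mul_right T)

/-- Sequences of vectors satisfying Bessel's inequality. -/
def IsBessel (u : ℕ → H) : Prop :=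
  ∀ (s : Finset ℕ) (x : H), ∑ k ∈ s, ‖⟪u k, x⟫_ℂ‖ ^ 2 ≤ ‖x‖ ^ 2

theorem IsBessel.norm_le {u : ℕ → H} (hu : IsBessel u) (k : ℕ) : ‖u k‖ ≤ 1 := by
  have h := hu {k} (u k)
  simp only [Finset.sum_singleton, inner_self_eq_norm_sq_to_K] at h
  simp at h
  by_contra! h1
  have h2 : 1 < ‖u k‖ ^ 2 := by nlinarith
  nlinarith

theorem IsBessel.sum_fin_le {u : ℕ → H} (hu : IsBessel u) (M : ℕ) (x : H) :
    ∑ k : Fin M, ‖⟪u k, x⟫_ℂ‖ ^ 2 ≤ ‖x‖ ^ 2 := by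
  rw [Fin.sum_univ_eq_sum_range (fun k => ‖⟪u k, x⟫_ℂ‖ ^ 2)]
  exact hu _ x

theorem IsBessel.of_orthonormal {d : ℕ} {w : Fin d → H} (hw : Orthonormal ℂ w) {u : ℕ → H}
    (h : ∀ i : Fin d, u i = w i) (h0 : ∀ k, d ≤ k → u k = 0) : IsBessel u := by
  intro s x
  calc ∑ k ∈ s, ‖⟪u k, x⟫_ℂ‖ ^ 2 ≤ ∑ k ∈ s ∪ Finset.range d, ‖⟪u k, x⟫_ℂ‖ ^ 2 :=
        Finset.sum_le_sum_of_subset_of_nonneg Finset.subset_union_left fun _ _ _ => by positivity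
    _ = ∑ k ∈ Finset.range d, ‖⟪u k, x⟫_ℂ‖ ^ 2 := by
        refine (Finset.sum_subset Finset.subset_union_right fun k _ hk => ?_).symm
        rw [h0 k (by simpa using hk)]
        simp
    _ = ∑ i : Fin d, ‖⟪w i, x⟫_ℂ‖ ^ 2 := by
        rw [← Fin.sum_univ_eq_sum_range (fun k => ‖⟪u k, x⟫_ℂ‖ ^ 2)]
        simp only [h]
    _ ≤ ‖x‖ ^ 2 := hw.sum_inner_products_le x

theorem sum_unit_sq_norm_le (Z : H →L[ℂ] H') (hZ : ‖Z‖ ≤ 1) (x : H) :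
    ∑ _a ∈ ({()} : Finset Unit), ‖Z x‖ ^ 2 ≤ ‖x‖ ^ 2 := by
  simp only [Finset.sum_singleton]
  gcongr
  exact (Z.le_of_opNorm_le hZ x).trans (by simp)

/-- `|T|_Φ` as a real number. -/
noncomputable def NormingFunction.gauge (Φ : NormingFunction) (T : H →L[ℂ] H) : ℝ :=
  Φ (singularSeq T)

theorem NormingFunction.gauge_nonneg (Φ : NormingFunction) (T : H →L[ℂ] H) : 0 ≤ Φ.gauge T :=
  Φ.nonneg _

theorem finiteRankNorm_eq (Φ : NormingFunction) (T : H →L[ℂ] H) :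
    finiteRankNorm Φ T = ENNReal.ofReal (Φ.gauge T) := rfl

theorem ker_orthogonal_finrank_le {T : H →L[ℂ] H} (hT : IsFiniteRank T) :
    ∃ _ : FiniteDimensional ℂ (LinearMap.ker (T : H →ₗ[ℂ] H))ᗮ,
      Module.finrank ℂ (LinearMap.ker (T : H →ₗ[ℂ] H))ᗮ
        ≤ Module.finrank ℂ (LinearMap.range (T : H →ₗ[ℂ] H)) := by
  have := hT
  unfold IsFiniteRank at this
  have hinj : Function.Injective
      ((T : H →ₗ[ℂ] H).rangeRestrict ∘ₗ (LinearMap.ker (T : H →ₗ[ℂ] H))ᗮ.subtype) := by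
    rw [← LinearMap.ker_eq_bot, LinearMap.ker_eq_bot']
    rintro ⟨x, hx⟩ h
    have hx0 : x ∈ LinearMap.ker (T : H →ₗ[ℂ] H) := by
      have := congrArg Subtype.val h
      simpa using this
    have : ⟪x, x⟫_ℂ = 0 := hx x hx0
    simpa using this
  exact ⟨Module.Finite.of_injective _ hinj, LinearMap.finrank_le_finrank_of_injective hinj⟩

/-- The singular value decomposition of an operator of finite rank. -/
theorem exists_svd [CompleteSpace H] {T : H →L[ℂ] H} (hT : IsFiniteRank T) :
    ∃ u v : ℕ → H, IsBessel u ∧ IsBessel v ∧ (∀ k, 0 ≤ singularSeq T k) ∧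
      (∀ k, (singularSeq T k : ℂ) = ⟪u k, T (v k)⟫_ℂ) ∧
      ∀ M, Module.finrank ℂ (LinearMap.range (T : H →ₗ[ℂ] H)) ≤ M →
        (∀ k, M ≤ k → singularSeq T k = 0) ∧
        ∀ x, T x = ∑ k : Fin M, ((singularSeq T k : ℂ) * ⟪v k, x⟫_ℂ) • u k := by
  obtain ⟨hfd, hrank⟩ := ker_orthogonal_finrank_le hT
  set E := (LinearMap.ker (T : H →ₗ[ℂ] H))ᗮ with hE
  set T' := ((T : H →ₗ[ℂ] H) ∘ₗ E.subtype).rangeRestrict with hT'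
  have hs : singularSeq T = T'.singularValues := by
    rw [singularSeq, dif_pos hfd]
  have hT'coe : ∀ x : E, ((T' x : _) : H) = T x := fun x => rfl
  have hinj : Function.Injective T' := by
    rw [← LinearMap.ker_eq_bot, LinearMap.ker_eq_bot']
    rintro ⟨x, hx⟩ h
    have hx0 : x ∈ LinearMap.ker (T : H →ₗ[ℂ] H) := by
      have := congrArg Subtype.val h
      simpa [hT'coe] using this
    have : ⟪x, x⟫_ℂ = 0 := hx x hx0
    simpa using this
  set d := Module.finrank ℂ E
  -- Restricted to `(ker T)ᗮ` the operator is injective, so all `d` singular values are positive and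
  -- the left singular vectors can be defined by division.
  have hpos : ∀ i : Fin d, 0 < T'.singularValues i := fun i =>
    T'.injective_iff_forall_lt_finrank_singularValues_pos.1 hinj i i.2
  set b := T'.isSymmetric_adjoint_comp_self.eigenvectorBasis rfl
  have hTb : ∀ i j, ⟪T (b i : H), T (b j : H)⟫_ℂ
      = if i = j then (T'.singularValues i : ℂ) ^ 2 else 0 := by
    intro i j
    have h1 : ⟪T' (b i), T' (b j)⟫_ℂ = ⟪b i, (T'.adjoint ∘ₗ T') (b j)⟫_ℂ := by
      rw [LinearMap.comp_apply, LinearMap.adjoint_inner_right]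
    rw [T'.isSymmetric_adjoint_comp_self.apply_eigenvectorBasis rfl j, inner_smul_right,
      orthonormal_iff_ite.1 b.orthonormal] at h1
    rw [Submodule.coe_inner] at h1
    refine h1.trans ?_
    split_ifs with h
    · subst h
      rw [mul_one, ← T'.sq_singularValues_fin rfl i]
      simp
    · simp
  let v : ℕ → H := fun k => if h : k < d then (b ⟨k, h⟩ : H) else 0
  let u : ℕ → H := fun k => ((T'.singularValues k : ℂ)⁻¹) • T (v k)
  have hv : ∀ i : Fin d, v i = b i := fun i => by simp [v]
  have hv0 : ∀ k, d ≤ k → v k = 0 := fun k hk => by simp [v, hk]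
  have hsu : ∀ k, T (v k) = (T'.singularValues k : ℂ) • u k := by
    intro k
    by_cases hk : k < d
    · have := (hpos ⟨k, hk⟩).ne'
      simp only [u, smul_smul]
      rw [mul_inv_cancel₀ (by exact_mod_cast this), one_smul]
    · simp [u, hv0 k (by omega)]
  have hu : ∀ i j : Fin d, ⟪u i, u j⟫_ℂ = if i = j then 1 else 0 := by
    intro i j
    simp only [u, inner_smul_left, inner_smul_right, hv, hTb]
    split_ifs with h
    · subst h
      have : (T'.singularValues i : ℂ) ≠ 0 := by exact_mod_cast (hpos i).ne'
      simp
      field_simp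
    · simp
  refine ⟨u, v, ?_, ?_, ?_, ?_, ?_⟩
  · exact IsBessel.of_orthonormal (w := fun i : Fin d => u i) (orthonormal_iff_ite.2 hu)
      (fun _ => rfl) (fun k hk => by simp [u, hv0 k hk])
  · exact IsBessel.of_orthonormal (w := fun i : Fin d => (b i : H))
      (b.orthonormal.comp_linearIsometry E.subtypeₗᵢ) hv hv0
  · intro k
    rw [hs]
    exact T'.singularValues_nonneg k
  · intro k
    rw [hs, hsu, inner_smul_right]
    by_cases hk : k < d
    · have := hu ⟨k, hk⟩ ⟨k, hk⟩
      simp only [if_true] at this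
      rw [this, mul_one]
    · rw [T'.singularValues_of_finrank_le (by omega)]
      simp
  · intro M hM
    have hdM : d ≤ M := hrank.trans hM
    refine ⟨fun k hk => ?_, fun x => ?_⟩
    · rw [hs]
      exact T'.singularValues_of_finrank_le (hdM.trans hk)
    · have hcl : IsClosed (LinearMap.ker (T : H →ₗ[ℂ] H) : Set H) := T.isClosed_ker
      have : CompleteSpace (LinearMap.ker (T : H →ₗ[ℂ] H)) := hcl.completeSpace_coe
      have hx : T x = T (E.starProjection x) := by
        have h1 := Submodule.starProjection_add_starProjection_orthogonal
          (K := LinearMap.ker (T : H →ₗ[ℂ] H)) x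
        have h2 : T ((LinearMap.ker (T : H →ₗ[ℂ] H)).starProjection x) = 0 :=
          Submodule.starProjection_apply_mem (LinearMap.ker (T : H →ₗ[ℂ] H)) x
        conv_lhs => rw [← h1]
        rw [map_add, h2, zero_add]
      have hx2 : E.starProjection x = ∑ i, ⟪(b i : H), x⟫_ℂ • (b i : H) := by
        have := congrArg Subtype.val (b.sum_repr' (E.orthogonalProjectionOnto x))
        rw [Submodule.starProjection_apply, ← this]
        simp
      rw [hx, hx2, map_sum]
      rw [Fin.sum_univ_eq_sum_range (fun k => ((singularSeq T k : ℂ) * ⟪v k, x⟫_ℂ) • u k),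
        ← Finset.sum_subset (Finset.range_mono hdM),
        ← Fin.sum_univ_eq_sum_range (fun k => ((singularSeq T k : ℂ) * ⟪v k, x⟫_ℂ) • u k)]
      · refine Finset.sum_congr rfl fun i _ => ?_
        rw [map_smul, ← hv, hsu, hs, smul_smul, mul_comm]
      · intro k _ hk
        rw [hv0 k (by simpa using hk)]
        simp

variable [CompleteSpace H]

theorem singularSeq_nonneg {T : H →L[ℂ] H} (hT : IsFiniteRank T) (k : ℕ) :
    0 ≤ singularSeq T k := by
  obtain ⟨u, v, -, -, h, -⟩ := exists_svd hT
  exact h k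

theorem singularSeq_le_norm {T : H →L[ℂ] H} (hT : IsFiniteRank T) (k : ℕ) :
    singularSeq T k ≤ ‖T‖ := by
  obtain ⟨u, v, hu, hv, h, hk, -⟩ := exists_svd hT
  have h1 : ‖(singularSeq T k : ℂ)‖ = singularSeq T k := by
    rw [Complex.norm_real, Real.norm_of_nonneg (h k)]
  rw [← h1, hk]
  calc _ ≤ ‖u k‖ * ‖T (v k)‖ := norm_inner_le_norm _ _
    _ ≤ 1 * (‖T‖ * 1) := by
      gcongr
      · exact hu.norm_le k
      · exact (T.le_opNorm _).trans (by gcongr; exact hv.norm_le k)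
    _ = ‖T‖ := by ring

theorem singularSeq_eq_zero {T : H →L[ℂ] H} (hT : IsFiniteRank T) {M k : ℕ}
    (hM : Module.finrank ℂ (LinearMap.range (T : H →ₗ[ℂ] H)) ≤ M) (hk : M ≤ k) :
    singularSeq T k = 0 := by
  obtain ⟨u, v, -, -, -, -, h⟩ := exists_svd hT
  exact (h M hM).1 k hk

variable [CompleteSpace H']

/-- The diagonal of a generalized compression of `T` is dominated by a substochastic average of
the singular values of `T`. -/
theorem exists_substochastic_bound {T : H →L[ℂ] H} (hT : IsFiniteRank T) {M : ℕ}
    (hM : Module.finrank ℂ (LinearMap.range (T : H →ₗ[ℂ] H)) ≤ M)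
    {e f : ℕ → H'} (he : IsBessel e) (hf : IsBessel f) {α : Type*} (s : Finset α)
    (X : α → H →L[ℂ] H') (Y : α → H' →L[ℂ] H)
    (hX : ∀ x, ∑ a ∈ s, ‖X a x‖ ^ 2 ≤ ‖x‖ ^ 2)
    (hX' : ∀ x, ∑ a ∈ s, ‖(X a).adjoint x‖ ^ 2 ≤ ‖x‖ ^ 2)
    (hY : ∀ x, ∑ a ∈ s, ‖Y a x‖ ^ 2 ≤ ‖x‖ ^ 2)
    (hY' : ∀ x, ∑ a ∈ s, ‖(Y a).adjoint x‖ ^ 2 ≤ ‖x‖ ^ 2) :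
    ∃ D : Matrix (Fin M) (Fin M) ℝ, NormingFunction.IsSubstochastic D ∧
      ∀ l : Fin M, ‖⟪e l, (∑ a ∈ s, X a ∘L T ∘L Y a) (f l)⟫_ℂ‖
        ≤ D.mulVec (fun k => singularSeq T k) l := by
  obtain ⟨u, v, hu, hv, hs0, -, hT'⟩ := exists_svd hT
  have hTM := (hT' M hM).2
  -- By the singular value expansion, the `l`-th diagonal entry is a sum over `k` of the `k`-th
  -- singular value times products `⟪v k, Y a (f l)⟫ * ⟪(X a)* e l, u k⟫`. The matrix entry is the
  -- arithmetic mean bound for these products. Its rows are controlled by Bessel for `u` and `v`,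
  -- its columns by Bessel for `e` and `f`.
  refine ⟨Matrix.of fun l k => (∑ a ∈ s, ‖⟪v k, Y a (f l)⟫_ℂ‖ ^ 2
    + ∑ a ∈ s, ‖⟪u k, (X a).adjoint (e l)⟫_ℂ‖ ^ 2) / 2, ⟨fun l k => ?_, fun l => ?_, fun k => ?_⟩,
    fun l => ?_⟩
  · simp only [Matrix.of_apply]
    positivity
  · simp only [Matrix.of_apply]
    rw [← Finset.sum_div, Finset.sum_add_distrib, Finset.sum_comm, Finset.sum_comm (s := Finset.univ)]
    have h1 : ∑ a ∈ s, ∑ k : Fin M, ‖⟪v k, Y a (f l)⟫_ℂ‖ ^ 2 ≤ 1 :=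
      calc _ ≤ ∑ a ∈ s, ‖Y a (f l)‖ ^ 2 := Finset.sum_le_sum fun a _ => hv.sum_fin_le M _
        _ ≤ ‖f l‖ ^ 2 := hY _
        _ ≤ 1 := pow_le_one₀ (norm_nonneg _) (hf.norm_le l)
    have h2 : ∑ a ∈ s, ∑ k : Fin M, ‖⟪u k, (X a).adjoint (e l)⟫_ℂ‖ ^ 2 ≤ 1 :=
      calc _ ≤ ∑ a ∈ s, ‖(X a).adjoint (e l)‖ ^ 2 :=
            Finset.sum_le_sum fun a _ => hu.sum_fin_le M _
        _ ≤ ‖e l‖ ^ 2 := hX' _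
        _ ≤ 1 := pow_le_one₀ (norm_nonneg _) (he.norm_le l)
    linarith
  · simp only [Matrix.of_apply]
    rw [← Finset.sum_div, Finset.sum_add_distrib, Finset.sum_comm, Finset.sum_comm (s := Finset.univ)]
    have h1 : ∑ a ∈ s, ∑ l : Fin M, ‖⟪v k, Y a (f l)⟫_ℂ‖ ^ 2 ≤ 1 :=
      calc _ = ∑ a ∈ s, ∑ l : Fin M, ‖⟪f l, (Y a).adjoint (v k)⟫_ℂ‖ ^ 2 := by
            refine Finset.sum_congr rfl fun a _ => Finset.sum_congr rfl fun l _ => ?_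
            rw [← ContinuousLinearMap.adjoint_inner_left, norm_inner_symm]
        _ ≤ ∑ a ∈ s, ‖(Y a).adjoint (v k)‖ ^ 2 :=
            Finset.sum_le_sum fun a _ => hf.sum_fin_le M _
        _ ≤ ‖v k‖ ^ 2 := hY' _
        _ ≤ 1 := pow_le_one₀ (norm_nonneg _) (hv.norm_le k)
    have h2 : ∑ a ∈ s, ∑ l : Fin M, ‖⟪u k, (X a).adjoint (e l)⟫_ℂ‖ ^ 2 ≤ 1 :=
      calc _ = ∑ a ∈ s, ∑ l : Fin M, ‖⟪e l, X a (u k)⟫_ℂ‖ ^ 2 := by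
            refine Finset.sum_congr rfl fun a _ => Finset.sum_congr rfl fun l _ => ?_
            rw [ContinuousLinearMap.adjoint_inner_right, norm_inner_symm]
        _ ≤ ∑ a ∈ s, ‖X a (u k)‖ ^ 2 :=
            Finset.sum_le_sum fun a _ => he.sum_fin_le M _
        _ ≤ ‖u k‖ ^ 2 := hX _
        _ ≤ 1 := pow_le_one₀ (norm_nonneg _) (hu.norm_le k)
    linarith
  · have h1 : ⟪e l, (∑ a ∈ s, X a ∘L T ∘L Y a) (f l)⟫_ℂ = ∑ k : Fin M, ∑ a ∈ s,
        (singularSeq T k : ℂ) * (⟪v k, Y a (f l)⟫_ℂ * ⟪(X a).adjoint (e l), u k⟫_ℂ) := by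
      rw [sum_apply, inner_sum, Finset.sum_comm]
      refine Finset.sum_congr rfl fun a _ => ?_
      rw [ContinuousLinearMap.comp_apply, ContinuousLinearMap.comp_apply,
        ← ContinuousLinearMap.adjoint_inner_left, hTM, inner_sum]
      refine Finset.sum_congr rfl fun k _ => ?_
      rw [inner_smul_right, mul_assoc]
    rw [h1]
    refine (norm_sum_le _ _).trans ?_
    simp only [Matrix.mulVec, dotProduct, Matrix.of_apply]
    refine Finset.sum_le_sum fun k _ => ?_
    rw [← Finset.mul_sum, norm_mul, Complex.norm_real, Real.norm_of_nonneg (hs0 k), mul_comm]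
    refine mul_le_mul_of_nonneg_right ?_ (hs0 k)
    rw [← Finset.sum_add_distrib, Finset.sum_div]
    refine (norm_sum_le _ _).trans (Finset.sum_le_sum fun a _ => ?_)
    rw [norm_mul, norm_inner_symm ((X a).adjoint (e l))]
    nlinarith [sq_nonneg (‖⟪v k, Y a (f l)⟫_ℂ‖ - ‖⟪u k, (X a).adjoint (e l)⟫_ℂ‖)]

namespace NormingFunction

variable (Φ : NormingFunction)

theorem gauge_eq_on {T : H →L[ℂ] H} (hT : IsFiniteRank T) {M : ℕ}
    (hM : Module.finrank ℂ (LinearMap.range (T : H →ₗ[ℂ] H)) ≤ M) :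
    Φ.gauge T = Φ.on (fun k : Fin M => singularSeq T k) :=
  Φ.eq_on _ fun _ hk => singularSeq_eq_zero hT hM hk

/-- This is the ideal property in a form that also covers pinchings. The singular values of the sum
are diagonal entries with respect to its own singular vectors, hence dominated by a substochastic
average of those of `T`. Domination and averaging each cost a factor 3. -/
theorem gauge_sum_comp_le {T : H →L[ℂ] H} (hT : IsFiniteRank T) {α : Type*} (s : Finset α)
    (X : α → H →L[ℂ] H') (Y : α → H' →L[ℂ] H)
    (hX : ∀ x, ∑ a ∈ s, ‖X a x‖ ^ 2 ≤ ‖x‖ ^ 2)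
    (hX' : ∀ x, ∑ a ∈ s, ‖(X a).adjoint x‖ ^ 2 ≤ ‖x‖ ^ 2)
    (hY : ∀ x, ∑ a ∈ s, ‖Y a x‖ ^ 2 ≤ ‖x‖ ^ 2)
    (hY' : ∀ x, ∑ a ∈ s, ‖(Y a).adjoint x‖ ^ 2 ≤ ‖x‖ ^ 2) :
    Φ.gauge (∑ a ∈ s, X a ∘L T ∘L Y a) ≤ 9 * Φ.gauge T := by
  set S := ∑ a ∈ s, X a ∘L T ∘L Y a with hSdef
  have hS : IsFiniteRank S := .sum fun a _ => (hT.comp_right (Y a)).comp_left (X a)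
  obtain ⟨e, f, he, hf, hs0, hs, -⟩ := exists_svd hS
  set M := max (Module.finrank ℂ (LinearMap.range (T : H →ₗ[ℂ] H)))
    (Module.finrank ℂ (LinearMap.range (S : H' →ₗ[ℂ] H')))
  obtain ⟨D, hD, hDs⟩ := exists_substochastic_bound hT (M := M) (le_max_left _ _) he hf s X Y
    hX hX' hY hY'
  rw [Φ.gauge_eq_on hS (le_max_right _ _ : _ ≤ M), Φ.gauge_eq_on hT (le_max_left _ _ : _ ≤ M)]
  have h1 := Φ.on_le_of_le (x := fun k : Fin M => singularSeq S k)
    (y := D.mulVec (fun k => singularSeq T k)) (fun k => hs0 k) fun l => by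
      have h3 : ‖(singularSeq S l : ℂ)‖ = singularSeq S l := by
        rw [Complex.norm_real, Real.norm_of_nonneg (hs0 l)]
      rw [← h3, hs]
      exact hDs l
  have h2 := Φ.on_substochastic_le hD (x := fun k : Fin M => singularSeq T k)
    fun k => singularSeq_nonneg hT k
  linarith

/-- Measured in the singular vectors of `S + T`, each singular value is a diagonal entry of `S` plus
one of `T`. Both are dominated by substochastic averages, and the factor is again 3 · 3. -/
theorem gauge_add_le {S T : H →L[ℂ] H} (hS : IsFiniteRank S) (hT : IsFiniteRank T) :
    Φ.gauge (S + T) ≤ 9 * (Φ.gauge S + Φ.gauge T) := by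
  have hST := hS.add hT
  obtain ⟨e, f, he, hf, hs0, hs, -⟩ := exists_svd hST
  set M := max (max (Module.finrank ℂ (LinearMap.range (S : H →ₗ[ℂ] H)))
    (Module.finrank ℂ (LinearMap.range (T : H →ₗ[ℂ] H))))
    (Module.finrank ℂ (LinearMap.range ((S + T : H →L[ℂ] H) : H →ₗ[ℂ] H)))
  have hMS : Module.finrank ℂ (LinearMap.range (S : H →ₗ[ℂ] H)) ≤ M :=
    (le_max_left _ _).trans (le_max_left _ _)
  have hMT : Module.finrank ℂ (LinearMap.range (T : H →ₗ[ℂ] H)) ≤ M :=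
    (le_max_right _ _).trans (le_max_left _ _)
  have h1 : ∀ x : H, ∑ a ∈ ({()} : Finset Unit), ‖(1 : H →L[ℂ] H) x‖ ^ 2 ≤ ‖x‖ ^ 2 := by simp
  have h1' : ∀ x : H, ∑ a ∈ ({()} : Finset Unit),
      ‖(ContinuousLinearMap.adjoint (1 : H →L[ℂ] H)) x‖ ^ 2 ≤ ‖x‖ ^ 2 := by
    intro x
    have : ContinuousLinearMap.adjoint (1 : H →L[ℂ] H) = 1 := star_one _
    simp [this]
  obtain ⟨D, hD, hDs⟩ := exists_substochastic_bound hS hMS he hf {()} (fun _ => 1) (fun _ => 1)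
    h1 h1' h1 h1'
  obtain ⟨D', hD', hDt⟩ := exists_substochastic_bound hT hMT he hf {()} (fun _ => 1) (fun _ => 1)
    h1 h1' h1 h1'
  rw [Φ.gauge_eq_on hST (le_max_right _ _ : _ ≤ M), Φ.gauge_eq_on hS hMS, Φ.gauge_eq_on hT hMT]
  have h2 := Φ.on_le_of_le (x := fun k : Fin M => singularSeq (S + T) k)
    (y := D.mulVec (fun k => singularSeq S k) + D'.mulVec (fun k => singularSeq T k))
    (fun k => hs0 k) fun l => by
      have h3 : ‖(singularSeq (S + T) l : ℂ)‖ = singularSeq (S + T) l := by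
        rw [Complex.norm_real, Real.norm_of_nonneg (hs0 l)]
      rw [← h3, hs, add_apply, inner_add_right]
      exact (norm_add_le _ _).trans (add_le_add (by simpa using hDs l) (by simpa using hDt l))
  have h3 := Φ.on_add (D.mulVec (fun k => singularSeq S k)) (D'.mulVec (fun k => singularSeq T k))
  have h4 := Φ.on_substochastic_le hD (x := fun k : Fin M => singularSeq S k)
    fun k => singularSeq_nonneg hS k
  have h5 := Φ.on_substochastic_le hD' (x := fun k : Fin M => singularSeq T k)
    fun k => singularSeq_nonneg hT k
  linarith

theorem gauge_comp_comp_le {T : H →L[ℂ] H} (hT : IsFiniteRank T) {X : H →L[ℂ] H'}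
    {Y : H' →L[ℂ] H} (hX : ‖X‖ ≤ 1) (hY : ‖Y‖ ≤ 1) :
    Φ.gauge (X ∘L T ∘L Y) ≤ 9 * Φ.gauge T := by
  have := Φ.gauge_sum_comp_le hT {()} (fun _ => X) (fun _ => Y) (sum_unit_sq_norm_le X hX)
    (sum_unit_sq_norm_le _ (by simpa using hX)) (sum_unit_sq_norm_le Y hY)
    (sum_unit_sq_norm_le _ (by simpa using hY))
  simpa using this

theorem gauge_mul_left_le {T : H →L[ℂ] H} (hT : IsFiniteRank T) {X : H →L[ℂ] H} (hX : ‖X‖ ≤ 1) :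
    Φ.gauge (X * T) ≤ 9 * Φ.gauge T := by
  have := Φ.gauge_comp_comp_le hT hX (Y := 1) (ContinuousLinearMap.norm_id_le)
  exact this

theorem gauge_mul_right_le {T : H →L[ℂ] H} (hT : IsFiniteRank T) {Y : H →L[ℂ] H} (hY : ‖Y‖ ≤ 1) :
    Φ.gauge (T * Y) ≤ 9 * Φ.gauge T := by
  have := Φ.gauge_comp_comp_le hT (X := 1) (ContinuousLinearMap.norm_id_le) hY
  exact this

theorem gauge_le_of_finrank_le {T : H →L[ℂ] H} (hT : IsFiniteRank T) {m : ℕ}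
    (hm : Module.finrank ℂ (LinearMap.range (T : H →ₗ[ℂ] H)) ≤ m) :
    Φ.gauge T ≤ 3 * (‖T‖ * Φ (onesSeq m)) := by
  rw [Φ.gauge_eq_on hT hm, onesSeq_eq_on]
  have := Φ.on_le_of_le (x := fun k : Fin m => singularSeq T k) (y := ‖T‖ • 1)
    (fun k => singularSeq_nonneg hT k) (fun k => by simpa using singularSeq_le_norm hT k)
  rwa [Φ.on_smul, abs_of_nonneg (norm_nonneg _)] at this

theorem gauge_zero : Φ.gauge (0 : H →L[ℂ] H) = 0 := by
  refine le_antisymm ?_ (Φ.gauge_nonneg _)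
  simpa using Φ.gauge_le_of_finrank_le (IsFiniteRank.zero (H := H) (H' := H)) le_rfl

end NormingFunction

end FiniteRank

/-! ### Approximate units and the modulus -/

section Modulus

variable {H : Type u} [NormedAddCommGroup H] [InnerProductSpace ℂ H] [CompleteSpace H]

/-- Finite rank positive contractions, as a predicate. -/
structure IsPosContraction (A : H →L[ℂ] H) : Prop where
  nonneg : 0 ≤ A
  norm_le : ‖A‖ ≤ 1
  finiteRank : IsFiniteRank A

namespace IsPosContraction

theorem of_nonneg_of_le_one {A : H →L[ℂ] H} (h0 : 0 ≤ A) (h1 : A ≤ 1) (h : IsFiniteRank A) :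
    IsPosContraction A :=
  ⟨h0, (CStarAlgebra.norm_le_one_iff_of_nonneg A h0).2 h1, h⟩

variable {A : H →L[ℂ] H} (hA : IsPosContraction A)
include hA

theorem le_one : A ≤ 1 := (CStarAlgebra.norm_le_one_iff_of_nonneg A hA.nonneg).1 hA.norm_le

theorem isSelfAdjoint : IsSelfAdjoint A := .of_nonneg hA.nonneg

theorem one_sub_nonneg : 0 ≤ 1 - A := sub_nonneg.2 hA.le_one

theorem one_sub_le : 1 - A ≤ 1 := sub_le_self _ hA.nonneg

theorem norm_one_sub_le : ‖1 - A‖ ≤ 1 :=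
  (CStarAlgebra.norm_le_one_iff_of_nonneg _ hA.one_sub_nonneg).2 hA.one_sub_le

theorem starProjection_mul {V : Submodule ℂ H} [V.HasOrthogonalProjection]
    (h : ∀ x, A x ∈ V) : V.starProjection * A = A := by
  ext x
  exact V.starProjection_eq_self_iff.2 (h x)

theorem mul_starProjection {V : Submodule ℂ H} [V.HasOrthogonalProjection]
    (h : ∀ x, A x ∈ V) : A * V.starProjection = A := by
  have h1 := congrArg star (hA.starProjection_mul h)
  rwa [star_mul, hA.isSelfAdjoint.star_eq, (isSelfAdjoint_starProjection V).star_eq] at h1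

theorem le_starProjection {V : Submodule ℂ H} [V.HasOrthogonalProjection]
    (h : ∀ x, A x ∈ V) : A ≤ V.starProjection := by
  have h1 := (isSelfAdjoint_starProjection V).conjugate_le_conjugate hA.le_one
  rwa [hA.starProjection_mul h, hA.mul_starProjection h, mul_one,
    V.isIdempotentElem_starProjection.eq] at h1

/-- Compressing `1 - A ≤ 1 - Q` by the projection `Q` gives `Q (1 - A) Q = 0`. Writing `1 - A = B*
B`, this says `B Q = 0`. -/
theorem apply_eq_of_starProjection_le {V : Submodule ℂ H} [V.HasOrthogonalProjection]
    (h : V.starProjection ≤ A) {x : H} (hx : x ∈ V) : A x = x := by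
  have h1 : 0 ≤ V.starProjection * (1 - A) * V.starProjection :=
    (isSelfAdjoint_starProjection V).conjugate_nonneg hA.one_sub_nonneg
  have h2 : V.starProjection * (1 - A) * V.starProjection ≤ 0 := by
    have := (isSelfAdjoint_starProjection V).conjugate_le_conjugate (sub_le_sub_left h 1)
    refine this.trans (le_of_eq ?_)
    rw [mul_sub, mul_one, V.isIdempotentElem_starProjection.eq, sub_self, zero_mul]
  have h3 := le_antisymm h2 h1
  have hP : V.starProjection x = x := V.starProjection_eq_self_iff.2 hx
  have hpos := (ContinuousLinearMap.nonneg_iff_isPositive _).1 hA.one_sub_nonneg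
  obtain ⟨B, hB⟩ := CStarAlgebra.nonneg_iff_eq_star_mul_self.1 hA.one_sub_nonneg
  have h4 : B * V.starProjection = 0 := by
    rw [← CStarRing.star_mul_self_eq_zero_iff, star_mul,
      (isSelfAdjoint_starProjection V).star_eq, ← h3, hB]
    simp only [mul_assoc]
  have h5 : (1 - A) x = 0 := by
    rw [hB]
    have := DFunLike.congr_fun h4 x
    rw [mul_apply_eq_comp, hP] at this
    rw [mul_apply_eq_comp, this]
    simp
  exact (sub_eq_zero.1 h5).symm

end IsPosContraction

theorem isPosContraction_starProjection (V : Submodule ℂ H) [FiniteDimensional ℂ V] :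
    IsPosContraction V.starProjection :=
  ⟨isStarProjection_starProjection.nonneg, V.starProjection_norm_le,
    .of_range_le V fun x => V.starProjection_apply_mem x⟩

/-- The finite rank positive contraction `1 - B C B`. -/
theorem IsPosContraction.one_sub_conj {A C : H →L[ℂ] H} (hA : IsPosContraction A)
    (hC : IsPosContraction C) : IsPosContraction (1 - (1 - A) * (1 - C) * (1 - A)) := by
  have hB : IsSelfAdjoint (1 - A) := .of_nonneg hA.one_sub_nonneg
  have h0 : 0 ≤ (1 - A) * (1 - C) * (1 - A) := hB.conjugate_nonneg hC.one_sub_nonneg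
  refine .of_nonneg_of_le_one (sub_nonneg.2 ?_) (sub_le_self _ h0) ?_
  · rw [← CStarAlgebra.norm_le_one_iff_of_nonneg _ h0]
    calc _ ≤ ‖1 - A‖ * ‖1 - C‖ * ‖1 - A‖ :=
          (norm_mul_le _ _).trans (by gcongr; exact norm_mul_le _ _)
      _ ≤ 1 * 1 * 1 := by
          gcongr
          exacts [hA.norm_one_sub_le, hC.norm_one_sub_le, hA.norm_one_sub_le]
      _ = 1 := by norm_num
  · have : 1 - (1 - A) * (1 - C) * (1 - A) = A * ((1 - C) * (1 - A)) + C * (1 - A) + A := by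
      noncomm_ring
    rw [this]
    exact ((hA.finiteRank.mul_right _).add (hC.finiteRank.mul_right _)).add hA.finiteRank

theorem IsPosContraction.one_sub_conj_projection_ge {A : H →L[ℂ] H} (hA : IsPosContraction A)
    (V : Submodule ℂ H) [FiniteDimensional ℂ V] :
    V.starProjection ≤ 1 - (1 - V.starProjection) * (1 - A) * (1 - V.starProjection) := by
  have hQ := (isStarProjection_starProjection (U := V)).one_sub
  have h := hQ.isSelfAdjoint.conjugate_le_conjugate hA.one_sub_le
  rw [mul_one, hQ.isIdempotentElem.eq] at h
  rw [le_sub_comm]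
  exact h

theorem exists_ge_starProjection (A₀ : FiniteRankPosContraction H) :
    ∃ V : Submodule ℂ H, ∃ _ : FiniteDimensional ℂ V, A₀.1 ≤ V.starProjection := by
  have h : IsPosContraction A₀.1 := ⟨A₀.2.1, A₀.2.2.1, A₀.2.2.2⟩
  have := A₀.2.2.2
  exact ⟨LinearMap.range (A₀.1 : H →ₗ[ℂ] H), this, h.le_starProjection fun x => ⟨x, rfl⟩⟩

instance : Nonempty (FiniteRankPosContraction H) :=
  ⟨⟨0, le_rfl, by simp, IsFiniteRank.zero⟩⟩

/-- Every finite rank positive contraction lies below the projection onto its range, and two such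
projections lie below the projection onto the sum of the ranges. -/
instance : IsDirectedOrder (FiniteRankPosContraction H) where
  directed A B := by
    obtain ⟨V, hV, hAV⟩ := exists_ge_starProjection A
    obtain ⟨W, hW, hBW⟩ := exists_ge_starProjection B
    have h := isPosContraction_starProjection (V ⊔ W)
    exact ⟨⟨(V ⊔ W).starProjection, h.nonneg, h.norm_le, h.finiteRank⟩,
      hAV.trans (Submodule.starProjection_le_starProjection_iff.2 le_sup_left),
      hBW.trans (Submodule.starProjection_le_starProjection_iff.2 le_sup_right)⟩

/-- The range of `T` has dimension at most `r`. -/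
def HasRankLE (T : H →L[ℂ] H) (r : ℕ) : Prop := LinearMap.rank (T : H →ₗ[ℂ] H) ≤ r

namespace HasRankLE

variable {S T : H →L[ℂ] H} {r s : ℕ}

theorem finrank_le (h : HasRankLE T r) : Module.finrank ℂ (LinearMap.range (T : H →ₗ[ℂ] H)) ≤ r :=
  Module.finrank_le_of_rank_le h

theorem isFiniteRank (h : HasRankLE T r) : IsFiniteRank T :=
  Module.rank_lt_aleph0_iff.1 (h.trans_lt (Cardinal.natCast_lt_aleph0))

theorem add (hS : HasRankLE S r) (hT : HasRankLE T s) : HasRankLE (S + T) (r + s) := by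
  unfold HasRankLE at *
  push_cast
  exact (LinearMap.rank_add_le _ _).trans (add_le_add hS hT)

theorem neg (hT : HasRankLE T r) : HasRankLE (-T) r := by
  have : ((-T : H →L[ℂ] H) : H →ₗ[ℂ] H) = (T : H →ₗ[ℂ] H) ∘ₗ (-LinearMap.id) := by
    ext x; simp
  unfold HasRankLE at *
  rw [this]
  exact (LinearMap.rank_comp_le_left _ _).trans hT

theorem sub (hS : HasRankLE S r) (hT : HasRankLE T s) : HasRankLE (S - T) (r + s) := by
  rw [sub_eq_add_neg]
  exact hS.add hT.neg

theorem mul_right (hT : HasRankLE T r) (Y : H →L[ℂ] H) : HasRankLE (T * Y) r :=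
  (LinearMap.rank_comp_le_left (Y : H →ₗ[ℂ] H) (T : H →ₗ[ℂ] H)).trans hT

theorem mul_left (hT : HasRankLE T r) (X : H →L[ℂ] H) : HasRankLE (X * T) r :=
  (LinearMap.rank_comp_le_right (T : H →ₗ[ℂ] H) (X : H →ₗ[ℂ] H)).trans hT

theorem starProjection (V : Submodule ℂ H) [FiniteDimensional ℂ V] :
    HasRankLE V.starProjection (Module.finrank ℂ V) := by
  unfold HasRankLE LinearMap.rank
  rw [Module.finrank_eq_rank]
  refine Submodule.rank_mono ?_
  rintro _ ⟨x, rfl⟩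
  exact V.starProjection_apply_mem x

theorem gauge_le (h : HasRankLE T r) (Φ : NormingFunction) :
    Φ.gauge T ≤ 3 * (‖T‖ * Φ (onesSeq r)) :=
  Φ.gauge_le_of_finrank_le h.isFiniteRank h.finrank_le

end HasRankLE

theorem norm_mul_starProjection_le (B : H →L[ℂ] H) (V : Submodule ℂ H) [FiniteDimensional ℂ V]
    {δ : ℝ} (hδ : 0 ≤ δ) (h : ∀ i, ‖B (stdOrthonormalBasis ℂ V i : H)‖ ≤ δ) :
    ‖B * V.starProjection‖ ≤ Module.finrank ℂ V * δ := by
  refine ContinuousLinearMap.opNorm_le_bound _ (by positivity) fun x => ?_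
  set b := stdOrthonormalBasis ℂ V
  have hx2 : V.starProjection x = ∑ i, ⟪(b i : H), x⟫_ℂ • (b i : H) := by
    have := congrArg Subtype.val (b.sum_repr' (V.orthogonalProjectionOnto x))
    rw [Submodule.starProjection_apply, ← this]
    simp
  rw [mul_apply_eq_comp, hx2, map_sum]
  calc _ ≤ ∑ i, ‖x‖ * δ := by
        refine norm_sum_le_of_le _ fun i _ => ?_
        rw [map_smul, norm_smul]
        gcongr
        · calc _ ≤ ‖(b i : H)‖ * ‖x‖ := norm_inner_le_norm _ _
            _ = ‖x‖ := by
              have : ‖(b i : H)‖ = 1 := b.orthonormal.1 i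
              rw [this, one_mul]
        · exact h i
    _ = _ := by simp; ring

/-- The `liminf` asks for contractions above a given `A₀`, whereas constructions give `A` that is
nearly the identity on finitely many vectors. With a finite rank projection `Q ≥ A₀`, the
contraction `1 - (1 - Q) (1 - A) (1 - Q)` dominates `Q` and differs from `A` by an operator of
bounded rank and small norm, so its commutators change little. The factor 9 is the one in
`gauge_add_le`. -/
theorem quasicentralModulus_le {n : ℕ} (φ : Fin n → NormingFunction) (τ : Fin n → H →L[ℂ] H)
    {c : ℝ} (hc : 0 ≤ c)
    (h : ∀ s : Finset H, ∀ δ > 0, ∃ A : H →L[ℂ] H, IsPosContraction A ∧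
      (∀ x ∈ s, ‖(1 - A) x‖ ≤ δ) ∧ ∀ j, (φ j).gauge (τ j * A - A * τ j) ≤ c) :
    quasicentralModulus φ τ ≤ ENNReal.ofReal (9 * c) := by
  classical
  refine ENNReal.le_of_forall_pos_le_add fun ε hε _ => ?_
  refine liminf_le_of_frequently_le' (frequently_atTop.2 fun A₀ => ?_)
  obtain ⟨V, hV, hA₀⟩ := exists_ge_starProjection A₀
  set d := Module.finrank ℂ V
  set K : ℝ := ∑ j, ‖τ j‖ * (φ j) (onesSeq (4 * d))
  have hK0 : ∀ j, 0 ≤ ‖τ j‖ * (φ j) (onesSeq (4 * d)) := fun j =>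
    mul_nonneg (norm_nonneg _) ((φ j).nonneg _)
  have hK : ∀ j, ‖τ j‖ * (φ j) (onesSeq (4 * d)) ≤ K := fun j =>
    Finset.single_le_sum (f := fun j => ‖τ j‖ * (φ j) (onesSeq (4 * d)))
      (fun j _ => hK0 j) (Finset.mem_univ j)
  have hKn : 0 ≤ K := Finset.sum_nonneg fun j _ => hK0 j
  -- Here 108 = 9 · 3 · 4: `gauge_add_le` gives 9, the rank bound for the gauge gives 3, and the
  -- norm of the commutator with the correction `D` gives 4.
  set δ : ℝ := ε / (108 * d * K + 1)
  have hden : 0 < 108 * d * K + 1 := by positivity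
  have hδ : 0 < δ := div_pos (by exact_mod_cast hε) hden
  obtain ⟨A, hA, hAs, hAc⟩ := h
    (Finset.univ.image fun i => (stdOrthonormalBasis ℂ V i : H)) δ hδ
  set Q := V.starProjection
  have hQ := isPosContraction_starProjection V
  set A' := 1 - (1 - Q) * (1 - A) * (1 - Q)
  have hA' : IsPosContraction A' := hQ.one_sub_conj hA
  have hQA' : Q ≤ A' := hA.one_sub_conj_projection_ge V
  refine ⟨⟨A', hA'.nonneg, hA'.norm_le, hA'.finiteRank⟩, hA₀.trans hQA', ?_⟩
  have hW : ‖(1 - A) * Q‖ ≤ d * δ := norm_mul_starProjection_le _ V hδ.le fun i =>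
    hAs _ (Finset.mem_image_of_mem _ (Finset.mem_univ i))
  have hW' : ‖Q * (1 - A)‖ ≤ d * δ := by
    have : star ((1 - A) * Q) = Q * (1 - A) := by
      rw [star_mul, hQ.isSelfAdjoint.star_eq, star_sub, star_one, hA.isSelfAdjoint.star_eq]
    rw [← this, norm_star]
    exact hW
  set D := A' - A
  have hD : D = Q * (1 - A) + (1 - Q) * ((1 - A) * Q) := by
    simp only [D, A']
    noncomm_ring
  have hDn : ‖D‖ ≤ 2 * (d * δ) := by
    rw [hD]
    calc _ ≤ ‖Q * (1 - A)‖ + ‖1 - Q‖ * ‖(1 - A) * Q‖ :=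
          (norm_add_le _ _).trans (by gcongr; exact norm_mul_le _ _)
      _ ≤ d * δ + 1 * (d * δ) := by gcongr; exact hQ.norm_one_sub_le
      _ = _ := by ring
  have hDr : HasRankLE D (d + d) := by
    rw [hD]
    exact ((HasRankLE.starProjection V).mul_right _).add
      (((HasRankLE.starProjection V).mul_left _).mul_left _)
  refine iSup_le fun j => ?_
  rw [finiteRankNorm_eq]
  have hε' : (ε : ℝ≥0∞) = ENNReal.ofReal ε := by simp
  rw [hε', ← ENNReal.ofReal_add (by positivity) (by positivity)]
  refine ENNReal.ofReal_le_ofReal ?_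
  have hsplit : τ j * A' - A' * τ j = (τ j * A - A * τ j) + (τ j * D - D * τ j) := by
    simp only [D]
    noncomm_ring
  have hCr : HasRankLE (τ j * D - D * τ j) (4 * d) := by
    have := (hDr.mul_left (τ j)).sub (hDr.mul_right (τ j))
    rwa [show d + d + (d + d) = 4 * d by ring] at this
  have hCn : ‖τ j * D - D * τ j‖ ≤ 4 * (d * δ) * ‖τ j‖ :=
    calc _ ≤ ‖τ j‖ * ‖D‖ + ‖D‖ * ‖τ j‖ :=
          (norm_sub_le _ _).trans (add_le_add (norm_mul_le _ _) (norm_mul_le _ _))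
      _ ≤ ‖τ j‖ * (2 * (d * δ)) + 2 * (d * δ) * ‖τ j‖ := by gcongr
      _ = _ := by ring
  change (φ j).gauge (τ j * A' - A' * τ j) ≤ _
  rw [hsplit]
  have h1 := (φ j).gauge_add_le (hA.finiteRank.commutator (τ j)) hCr.isFiniteRank
  have h2 := hCr.gauge_le (φ j)
  have h3 : ‖τ j * D - D * τ j‖ * (φ j) (onesSeq (4 * d)) ≤ 4 * (d * δ) * K := by
    calc _ ≤ 4 * (d * δ) * ‖τ j‖ * (φ j) (onesSeq (4 * d)) := by
          gcongr
          exact (φ j).nonneg _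
      _ = 4 * (d * δ) * (‖τ j‖ * (φ j) (onesSeq (4 * d))) := by ring
      _ ≤ _ := by gcongr; exact hK j
  have h4 : 108 * d * K * δ ≤ ε := by
    rw [mul_div_assoc', div_le_iff₀ hden, mul_comm]
    have : (0 : ℝ) ≤ ε := ε.2
    nlinarith
  have h5 := hAc j
  nlinarith

/-- Vectors can be treated one at a time: combine `A` and `C` into `1 - (1 - A) (1 - C) (1 - A)`.
The quasi-triangle constants accumulate with the length of the list, but `δ` is arbitrary, so they
can be absorbed at each step. -/
theorem exists_posContraction_list {n : ℕ} (φ : Fin n → NormingFunction) (τ : Fin n → H →L[ℂ] H)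
    (h : ∀ v : H, ∀ δ > 0, ∃ A : H →L[ℂ] H, IsPosContraction A ∧
      ‖(1 - A) v‖ ≤ δ ∧ ∀ j, (φ j).gauge (τ j * A - A * τ j) ≤ δ) (r : ℕ) :
    ∀ l : List H, l.length = r → ∀ δ > 0, ∃ A : H →L[ℂ] H, IsPosContraction A ∧
      (∀ x ∈ l, ‖(1 - A) x‖ ≤ δ) ∧ ∀ j, (φ j).gauge (τ j * A - A * τ j) ≤ δ := by
  induction r with
  | zero =>
    intro l hl δ hδ
    obtain ⟨A, hA, -, hA'⟩ := h 0 δ hδ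
    rw [List.length_eq_zero_iff] at hl
    subst hl
    exact ⟨A, hA, by simp, hA'⟩
  | succ r ih =>
    intro l hl δ hδ
    obtain ⟨v, l, rfl⟩ := List.exists_cons_of_length_eq_add_one hl
    -- The three-term expansion of the commutator costs 9 · (9 · (9 + 81) + 9) = 7371.
    have hδ' : 0 < δ / 10000 := by positivity
    obtain ⟨A, hA, hAv, hAc⟩ := h v _ hδ'
    -- `C` is chosen for the images under `1 - A`, since that factor acts first. The new vector `v`
    -- is already made small by that factor.
    obtain ⟨C, hC, hCl, hCc⟩ := ih (l.map (1 - A : H →L[ℂ] H)) (by simpa using hl) _ hδ'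
    refine ⟨_, hA.one_sub_conj hC, ?_, fun j => ?_⟩
    · intro x hx
      have hB1 : ∀ x, ‖(1 - A) x‖ ≤ ‖x‖ := fun x => by
        simpa using ContinuousLinearMap.le_of_opNorm_le _ hA.norm_one_sub_le x
      have hC1 : ∀ x, ‖(1 - C) x‖ ≤ ‖x‖ := fun x => by
        simpa using ContinuousLinearMap.le_of_opNorm_le _ hC.norm_one_sub_le x
      rw [sub_sub_cancel, mul_apply_eq_comp, mul_apply_eq_comp]
      refine (hB1 _).trans ?_
      rcases List.mem_cons.1 hx with rfl | hx
      · exact (hC1 _).trans (hAv.trans (by linarith))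
      · exact (hCl _ (List.mem_map_of_mem hx)).trans (by linarith)
    · have hsplit : τ j * (1 - (1 - A) * (1 - C) * (1 - A)) - (1 - (1 - A) * (1 - C) * (1 - A)) * τ j
          = (τ j * A - A * τ j) * ((1 - C) * (1 - A))
            + (1 - A) * ((τ j * C - C * τ j) * (1 - A))
            + ((1 - A) * (1 - C)) * (τ j * A - A * τ j) := by
        noncomm_ring
      have hn : ∀ X Y : H →L[ℂ] H, ‖X‖ ≤ 1 → ‖Y‖ ≤ 1 → ‖X * Y‖ ≤ 1 := fun X Y hX hY =>
        (norm_mul_le _ _).trans (mul_le_one₀ hX (norm_nonneg _) hY)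
      have f1 := hA.finiteRank.commutator (τ j)
      have f2 := hC.finiteRank.commutator (τ j)
      rw [hsplit]
      have g1 := (φ j).gauge_mul_right_le f1 (hn _ _ hC.norm_one_sub_le hA.norm_one_sub_le)
      have g2 := (φ j).gauge_mul_left_le (f2.mul_right (1 - A)) hA.norm_one_sub_le
      have g2' := (φ j).gauge_mul_right_le f2 hA.norm_one_sub_le
      have g3 := (φ j).gauge_mul_left_le f1 (hn _ _ hA.norm_one_sub_le hC.norm_one_sub_le)
      have g4 := (φ j).gauge_add_le (f1.mul_right ((1 - C) * (1 - A)))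
        ((f2.mul_right (1 - A)).mul_left (1 - A))
      have g5 := (φ j).gauge_add_le ((f1.mul_right ((1 - C) * (1 - A))).add
        ((f2.mul_right (1 - A)).mul_left (1 - A))) (f1.mul_left ((1 - A) * (1 - C)))
      have := hAc j
      have := hCc j
      linarith

theorem quasicentralModulus_eq_zero {n : ℕ} (φ : Fin n → NormingFunction) (τ : Fin n → H →L[ℂ] H)
    (h : ∀ v : H, ∀ δ > 0, ∃ A : H →L[ℂ] H, IsPosContraction A ∧
      ‖(1 - A) v‖ ≤ δ ∧ ∀ j, (φ j).gauge (τ j * A - A * τ j) ≤ δ) :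
    quasicentralModulus φ τ = 0 := by
  refine le_antisymm (ENNReal.le_of_forall_pos_le_add fun ε hε _ => ?_) zero_le
  have hε' : (0 : ℝ) < ε := by exact_mod_cast hε
  have := quasicentralModulus_le φ τ (c := ε / 9) (by positivity) fun s δ hδ => by
    obtain ⟨A, hA, h1, h2⟩ := exists_posContraction_list φ τ h _ s.toList rfl
      (min δ (ε / 9)) (by positivity)
    exact ⟨A, hA, fun x hx => (h1 x (by simpa using hx)).trans (min_le_left _ _),
      fun j => (h2 j).trans (min_le_right _ _)⟩
  rw [mul_div_cancel₀ _ (by norm_num : (9 : ℝ) ≠ 0)] at this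
  simpa using this

/-- Below a bound for the modulus there are finite rank positive contractions with small
commutators acting as the identity on a given finite dimensional space. -/
theorem exists_posContraction_of_quasicentralModulus_lt {n : ℕ} {φ : Fin n → NormingFunction}
    {τ : Fin n → H →L[ℂ] H} {c : ℝ} (hc : 0 < c)
    (h : quasicentralModulus φ τ < ENNReal.ofReal c) (V : Submodule ℂ H)
    [FiniteDimensional ℂ V] :
    ∃ A : H →L[ℂ] H, IsPosContraction A ∧ (∀ x ∈ V, A x = x) ∧
      ∀ j, (φ j).gauge (τ j * A - A * τ j) ≤ c := by
  have hV := isPosContraction_starProjection V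
  obtain ⟨A, hVA, hA⟩ := frequently_atTop.1 (frequently_lt_of_liminf_lt (h := h))
    ⟨V.starProjection, hV.nonneg, hV.norm_le, hV.finiteRank⟩
  have hA' : IsPosContraction A.1 := ⟨A.2.1, A.2.2.1, A.2.2.2⟩
  refine ⟨A.1, hA', fun x hx => hA'.apply_eq_of_starProjection_le hVA hx, fun j => ?_⟩
  have := (le_iSup (fun j => finiteRankNorm (φ j) (τ j * A.1 - A.1 * τ j)) j).trans hA.le
  rw [finiteRankNorm_eq] at this
  exact (ENNReal.ofReal_le_ofReal_iff hc.le).1 this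

end Modulus

/-! ### Spectral partitions of a hermitian operator -/

section SpectralPartition

variable {H : Type u} [NormedAddCommGroup H] [InnerProductSpace ℂ H] [CompleteSpace H]

/-- Invariance says `P T P = T P`; taking adjoints gives `P T P = P T`. -/
theorem commute_starProjection_of_invariant {T : H →L[ℂ] H} (hT : IsSelfAdjoint T)
    (V : Submodule ℂ H) [V.HasOrthogonalProjection] (h : ∀ x ∈ V, T x ∈ V) :
    Commute V.starProjection T := by
  have h1 : V.starProjection * T * V.starProjection = T * V.starProjection := by
    ext x
    exact V.starProjection_eq_self_iff.2 (h _ (V.starProjection_apply_mem x))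
  have h2 := congrArg star h1
  rw [star_mul, star_mul, star_mul, hT.star_eq, (isSelfAdjoint_starProjection V).star_eq,
    ← mul_assoc, h1] at h2
  exact h2.symm

/-- The projection onto the part of `X` below `t`, that is, onto the kernel of `(X - t)⁺`. -/
noncomputable def lowerProjection (X : H →L[ℂ] H) (t : ℝ) : H →L[ℂ] H :=
  (LinearMap.ker (((X - algebraMap ℝ _ t)⁺ : H →L[ℂ] H) : H →ₗ[ℂ] H)).starProjection

theorem isStarProjection_lowerProjection (X : H →L[ℂ] H) (t : ℝ) :
    IsStarProjection (lowerProjection X t) := isStarProjection_starProjection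

section

variable {X : H →L[ℂ] H} (hX : IsSelfAdjoint X) (t : ℝ)
include hX

theorem isSelfAdjoint_sub_algebraMap : IsSelfAdjoint (X - algebraMap ℝ (H →L[ℂ] H) t) :=
  hX.sub (.algebraMap _ (.all t))

/-- The positive part of `X - t` lies in the functional calculus of `X - t`, so it commutes with
`T`, and `T` preserves its kernel. -/
theorem commute_lowerProjection {T : H →L[ℂ] H} (hT : IsSelfAdjoint T) (h : Commute X T) :
    Commute (lowerProjection X t) T := by
  have hs := isSelfAdjoint_sub_algebraMap hX t
  have hc : Commute (X - algebraMap ℝ (H →L[ℂ] H) t) T :=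
    h.sub_left (Algebra.commute_algebraMap_left t T)
  have hp : Commute ((X - algebraMap ℝ (H →L[ℂ] H) t)⁺) T := by
    rw [CFC.posPart_def]
    exact hc.cfcₙ (by rwa [hs.star_eq]) _
  refine commute_starProjection_of_invariant hT _ fun x hx => ?_
  have h1 := DFunLike.congr_fun hp.eq x
  have hx' : ((X - algebraMap ℝ (H →L[ℂ] H) t)⁺) x = 0 := hx
  simp only [mul_apply_eq_comp, hx', map_zero] at h1
  exact h1

theorem posPart_mul_lowerProjection :
    (X - algebraMap ℝ (H →L[ℂ] H) t)⁺ * lowerProjection X t = 0 := by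
  ext x
  exact Submodule.starProjection_apply_mem
    (LinearMap.ker (((X - algebraMap ℝ _ t)⁺ : H →L[ℂ] H) : H →ₗ[ℂ] H)) x

/-- Positive and negative parts annihilate each other, so the range of the negative part lies in the
kernel that defines the projection. -/
theorem negPart_mul_one_sub_lowerProjection :
    (X - algebraMap ℝ (H →L[ℂ] H) t)⁻ * (1 - lowerProjection X t) = 0 := by
  set a := (X - algebraMap ℝ (H →L[ℂ] H) t)⁺
  set b := (X - algebraMap ℝ (H →L[ℂ] H) t)⁻
  have hab : a * b = 0 := CFC.posPart_mul_negPart _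
  have hb : IsSelfAdjoint b := .of_nonneg (CFC.negPart_nonneg _)
  have h : lowerProjection X t * b = b := by
    ext x
    exact Submodule.starProjection_eq_self_iff.2 (DFunLike.congr_fun hab x)
  have h2 := congrArg star h
  rw [star_mul, hb.star_eq, (isStarProjection_lowerProjection X t).isSelfAdjoint.star_eq] at h2
  rw [mul_sub, mul_one, h2, sub_self]

theorem conj_lowerProjection_nonpos :
    lowerProjection X t * (X - algebraMap ℝ _ t) * lowerProjection X t ≤ 0 := by
  have hs := isSelfAdjoint_sub_algebraMap hX t
  have he := (isStarProjection_lowerProjection X t).isSelfAdjoint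
  conv_lhs => rw [← CFC.posPart_sub_negPart _ hs]
  rw [mul_sub, sub_mul, mul_assoc _ _⁺, posPart_mul_lowerProjection hX, mul_zero, zero_sub]
  exact neg_nonpos.2 (he.conjugate_nonneg (CFC.negPart_nonneg _))

theorem conj_one_sub_lowerProjection_nonneg :
    0 ≤ (1 - lowerProjection X t) * (X - algebraMap ℝ _ t) * (1 - lowerProjection X t) := by
  have hs := isSelfAdjoint_sub_algebraMap hX t
  have he := (isStarProjection_lowerProjection X t).one_sub.isSelfAdjoint
  conv_rhs => rw [← CFC.posPart_sub_negPart _ hs]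
  rw [mul_sub (1 - _), sub_mul _ _ (1 - _), mul_assoc _ _⁻, negPart_mul_one_sub_lowerProjection hX, mul_zero, sub_zero]
  exact he.conjugate_nonneg (CFC.posPart_nonneg _)

theorem lowerProjection_eq_one (h : X ≤ algebraMap ℝ _ t) : lowerProjection X t = 1 := by
  have hs := isSelfAdjoint_sub_algebraMap hX t
  have h0 : (X - algebraMap ℝ (H →L[ℂ] H) t)⁺ = 0 :=
    (CFC.posPart_eq_zero_iff _ hs).2 (sub_nonpos.2 h)
  ext x
  refine Submodule.starProjection_eq_self_iff.2 ?_
  rw [LinearMap.mem_ker, h0]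
  rfl

end

/-- A partition of the identity into projections that commute with the commutant of `X` and on
each of which `X` is within `c` of a constant. -/
structure IsSpectralPartition (X : H →L[ℂ] H) (N : ℕ) (c : ℝ) (F : ℕ → H →L[ℂ] H) (y : ℕ → ℝ) :
    Prop where
  isSelfAdjoint : ∀ i, IsSelfAdjoint (F i)
  idem : ∀ i, F i * F i = F i
  orthogonal : ∀ i j, i ≠ j → F i * F j = 0
  sum_eq_one : ∑ i ∈ Finset.range N, F i = 1
  commute : ∀ T, IsSelfAdjoint T → Commute X T → ∀ i, Commute (F i) T
  norm_sub_le : ‖X - ∑ i ∈ Finset.range N, y i • F i‖ ≤ c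

/-- The thresholds `y i` cut `[-R, R]` into `N` intervals of length `c`. The piece `F i` is the part
below `y (i + 1)` and above the earlier thresholds, so `X` compressed to it lies between `y i` and
`y (i + 1)`. Since `F i = G i - G (i + 1)`, the sum telescopes, and it closes up because nothing
lies above `y N = R`. -/
theorem exists_isSpectralPartition {X : H →L[ℂ] H} (hX : IsSelfAdjoint X) {R : ℝ} (hR : ‖X‖ ≤ R)
    {N : ℕ} (hN : 0 < N) : ∃ F y, IsSpectralPartition X N (2 * R / N) F y := by
  have hR0 : 0 ≤ R := (norm_nonneg X).trans hR
  set c : ℝ := 2 * R / N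
  have hc : 0 ≤ c := by positivity
  let y : ℕ → ℝ := fun i => -R + c * i
  let e : ℕ → H →L[ℂ] H := fun i => lowerProjection X (y i)
  have he : ∀ i, IsStarProjection (e i) := fun i => isStarProjection_lowerProjection _ _
  have hcomm : ∀ T, IsSelfAdjoint T → Commute X T → ∀ i, Commute (e i) T := fun T hT h i =>
    commute_lowerProjection hX _ hT h
  have heX : ∀ i, Commute (e i) X := hcomm X hX (.refl X)
  have hee : ∀ i j, Commute (e i) (e j) := fun i j =>
    hcomm _ (he j).isSelfAdjoint (heX j).symm i
  have hXle : X ≤ algebraMap ℝ _ R :=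
    hX.le_algebraMap_norm_self.trans (algebraMap_mono _ hR)
  have hXge : algebraMap ℝ _ (-R) ≤ X := by
    refine le_trans ?_ hX.neg_algebraMap_norm_le_self
    rw [map_neg]
    exact neg_le_neg (algebraMap_mono _ hR)
  have heN : e N = 1 := by
    refine lowerProjection_eq_one hX _ (hXle.trans (le_of_eq ?_))
    congr 1
    simp only [y, c]
    field_simp
    ring
  -- The product starts with `1 - e 1`, not `1 - e 0`: for the first piece the lower bound is the
  -- global one, `X ≥ -R = y 0`.
  let G : ℕ → H →L[ℂ] H := fun i => Nat.rec 1 (fun i g => g * (1 - e (i + 1))) i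
  have hG0 : G 0 = 1 := rfl
  have hGs : ∀ i, G (i + 1) = G i * (1 - e (i + 1)) := fun i => rfl
  have hGc : ∀ T, IsSelfAdjoint T → Commute X T → ∀ i, Commute (G i) T := by
    intro T hT h i
    induction i with
    | zero => exact Commute.one_left T
    | succ i ih =>
      rw [hGs]
      exact ih.mul_left ((Commute.one_left T).sub_left (hcomm T hT h _))
  have hGe : ∀ i j, Commute (G i) (e j) := fun i j => hGc _ (he j).isSelfAdjoint (heX j).symm i
  have hGe' : ∀ i j, Commute (G i) (1 - e j) := fun i j =>
    (Commute.one_right _).sub_right (hGe i j)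
  have hGp : ∀ i, IsStarProjection (G i) := by
    intro i
    induction i with
    | zero => exact IsStarProjection.one _
    | succ i ih =>
      rw [hGs]
      exact ih.mul (he _).one_sub (hGe' _ _)
  have hGX : ∀ i, Commute (G i) X := hGc X hX (.refl X)
  let F : ℕ → H →L[ℂ] H := fun i => G i * e (i + 1)
  have hFG : ∀ i, F i = G i - G (i + 1) := fun i => by
    simp only [F, hGs]
    noncomm_ring
  have hFp : ∀ i, IsStarProjection (F i) := fun i => (hGp i).mul (he _) (hGe _ _)
  have hGje : ∀ i j, i < j → G j * e (i + 1) = 0 := by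
    intro i j hij
    induction j, hij using Nat.le_induction with
    | base => rw [hGs, mul_assoc, sub_mul, one_mul, (he _).isIdempotentElem.eq, sub_self, mul_zero]
    | succ j _ ih =>
      have : Commute (1 - e (j + 1)) (e (i + 1)) := (Commute.one_left _).sub_left (hee _ _)
      rw [hGs, mul_assoc, this.eq, ← mul_assoc, ih, zero_mul]
  have horth : ∀ i j, i < j → F j * F i = 0 := by
    intro i j hij
    have h1 : Commute (G j) (e (j + 1) * G i) :=
      (hGe j _).mul_right (hGc _ (hGp i).isSelfAdjoint (hGX i).symm j)
    calc F j * F i = (G j * (e (j + 1) * G i)) * e (i + 1) := by simp only [F, mul_assoc]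
      _ = e (j + 1) * G i * (G j * e (i + 1)) := by rw [h1.eq, mul_assoc]
      _ = 0 := by rw [hGje i j hij, mul_zero]
  have hFc : ∀ T, IsSelfAdjoint T → Commute X T → ∀ i, Commute (F i) T := fun T hT h i =>
    (hGc T hT h i).mul_left (hcomm T hT h _)
  have horth' : ∀ i j, i ≠ j → F i * F j = 0 := by
    intro i j hij
    rcases lt_or_gt_of_ne hij with h | h
    · have hFX := hFc X hX (.refl X) j
      rw [(hFc _ (hFp j).isSelfAdjoint hFX.symm i).eq]
      exact horth i j h
    · exact horth j i h
  have hsum : ∑ i ∈ Finset.range N, F i = 1 := by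
    simp only [hFG]
    rw [Finset.sum_range_sub', hG0]
    obtain ⟨M, rfl⟩ := Nat.exists_eq_succ_of_ne_zero hN.ne'
    rw [Nat.succ_eq_add_one] at heN ⊢
    rw [hGs, heN, sub_self, mul_zero, sub_zero]
  have hup : ∀ i, F i * (X - algebraMap ℝ _ (y (i + 1))) * F i ≤ 0 := by
    intro i
    have := (hGp i).isSelfAdjoint.conjugate_le_conjugate (conj_lowerProjection_nonpos hX (y (i + 1)))
    refine le_trans (le_of_eq ?_) (this.trans (by simp))
    change _ = G i * (e (i + 1) * (X - algebraMap ℝ _ (y (i + 1))) * e (i + 1)) * G i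
    calc _ = G i * e (i + 1) * (X - algebraMap ℝ _ (y (i + 1))) * (G i * e (i + 1)) := rfl
      _ = _ := by rw [(hGe i (i + 1)).eq]; nth_rewrite 1 [← (hGe i (i + 1)).eq]; simp only [mul_assoc]
  have hlow : ∀ i, 0 ≤ F i * (X - algebraMap ℝ _ (y i)) * F i := by
    intro i
    cases i with
    | zero =>
      refine (hFp 0).isSelfAdjoint.conjugate_nonneg (sub_nonneg.2 ?_)
      simpa [y] using hXge
    | succ i =>
      have h1 : F (i + 1) * (1 - e (i + 1)) = F (i + 1) := by
        have : Commute (e (i + 1 + 1)) (1 - e (i + 1)) :=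
          (Commute.one_right _).sub_right (hee _ _)
        simp only [F]
        rw [mul_assoc, this.eq, ← mul_assoc, hGs, mul_assoc (G i), (he _).one_sub.isIdempotentElem.eq]
      have h2 : (1 - e (i + 1)) * F (i + 1) = F (i + 1) := by
        have := congrArg star h1
        rwa [star_mul, (hFp (i + 1)).isSelfAdjoint.star_eq,
          (he (i + 1)).one_sub.isSelfAdjoint.star_eq] at this
      have := (hFp (i + 1)).isSelfAdjoint.conjugate_nonneg
        (conj_one_sub_lowerProjection_nonneg hX (y (i + 1)))
      refine this.trans (le_of_eq ?_)
      change F (i + 1) * ((1 - e (i + 1)) * (X - algebraMap ℝ _ (y (i + 1))) * (1 - e (i + 1)))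
        * F (i + 1) = _
      calc _ = F (i + 1) * (1 - e (i + 1)) * (X - algebraMap ℝ _ (y (i + 1)))
            * ((1 - e (i + 1)) * F (i + 1)) := by simp only [mul_assoc]
        _ = _ := by rw [h1, h2]
  have hterm : ∀ i, F i * (X - algebraMap ℝ _ (y i)) * F i = X * F i - y i • F i := by
    intro i
    rw [mul_sub, sub_mul, (hFc X hX (.refl X) i).eq, mul_assoc, (hFp i).isIdempotentElem.eq,
      Algebra.algebraMap_eq_smul_one, mul_smul_comm, mul_one, smul_mul_assoc,
      (hFp i).isIdempotentElem.eq]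
  have hY : X - ∑ i ∈ Finset.range N, y i • F i
      = ∑ i ∈ Finset.range N, F i * (X - algebraMap ℝ _ (y i)) * F i := by
    simp only [hterm]
    rw [Finset.sum_sub_distrib, ← Finset.mul_sum, hsum, mul_one]
  refine ⟨F, y, fun i => (hFp i).isSelfAdjoint, fun i => (hFp i).isIdempotentElem.eq, horth', hsum,
    hFc, ?_⟩
  -- The error is a positive operator, so an order bound by `c` suffices; that bound holds piece by
  -- piece.
  rw [hY, CStarAlgebra.norm_le_iff_le_algebraMap _ hc (Finset.sum_nonneg fun i _ => hlow i)]
  calc _ ≤ ∑ i ∈ Finset.range N, c • F i := by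
        refine Finset.sum_le_sum fun i _ => ?_
        have h1 := hup i
        have h2 : F i * (X - algebraMap ℝ _ (y (i + 1))) * F i
            = F i * (X - algebraMap ℝ _ (y i)) * F i - c • F i := by
          have : algebraMap ℝ (H →L[ℂ] H) (y (i + 1))
              = algebraMap ℝ _ (y i) + algebraMap ℝ _ c := by
            rw [← map_add]
            congr 1
            simp only [y]
            push_cast
            ring
          have h3 : F i * algebraMap ℝ (H →L[ℂ] H) c * F i = c • F i := by
            rw [Algebra.algebraMap_eq_smul_one, mul_smul_comm, mul_one, smul_mul_assoc,
              (hFp i).isIdempotentElem.eq]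
          rw [this, ← h3]
          noncomm_ring
        rw [h2] at h1
        exact sub_nonpos.1 h1
    _ = _ := by rw [← Finset.smul_sum, hsum, Algebra.algebraMap_eq_smul_one]

end SpectralPartition

/-! ### Part (a): projections built from a cyclic vector -/

section CyclicBound

variable {H : Type u} [NormedAddCommGroup H] [InnerProductSpace ℂ H] [CompleteSpace H]

/-- A vector lies in a subspace of controlled dimension that is invariant under commuting
spectral partitions. -/
theorem exists_invariant_subspace {n : ℕ} {F : Fin n → ℕ → H →L[ℂ] H} {N : Fin n → ℕ}
    (hidem : ∀ k i, F k i * F k i = F k i) (horth : ∀ k i j, i ≠ j → F k i * F k j = 0)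
    (hsum : ∀ k, ∑ i ∈ Finset.range (N k), F k i = 1)
    (hcomm : ∀ k l i j, Commute (F k i) (F l j)) (ξ : H) (s : Finset (Fin n)) :
    ∃ V : Submodule ℂ H, ∃ _ : FiniteDimensional ℂ V, ξ ∈ V ∧
      Module.finrank ℂ V ≤ ∏ k ∈ s, N k ∧ ∀ k ∈ s, ∀ i, ∀ x ∈ V, F k i x ∈ V := by
  classical
  induction s using Finset.induction_on with
  | empty =>
    refine ⟨Submodule.span ℂ {ξ}, inferInstance, Submodule.mem_span_singleton_self ξ, ?_, by simp⟩
    simpa using finrank_span_le_card (R := ℂ) ({ξ} : Set H)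
  | insert k s hk ih =>
    obtain ⟨V, hV, hξ, hdim, hinv⟩ := ih
    -- The enlarged space is the sum of the images of `V` under the `N k` pieces of the `k`-th
    -- partition, so its dimension grows by a factor of at most `N k`.
    let L : (Fin (N k) → V) →ₗ[ℂ] H :=
      ∑ i : Fin (N k), (F k i : H →ₗ[ℂ] H) ∘ₗ V.subtype ∘ₗ LinearMap.proj i
    have hL : ∀ f, L f = ∑ i : Fin (N k), F k i (f i) := fun f => by simp [L]
    refine ⟨LinearMap.range L, inferInstance, ?_, ?_, ?_⟩
    · refine ⟨fun _ => ⟨ξ, hξ⟩, ?_⟩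
      rw [hL, Fin.sum_univ_eq_sum_range (fun i => F k i ξ)]
      have := DFunLike.congr_fun (hsum k) ξ
      rwa [sum_apply] at this
    · rw [Finset.prod_insert hk]
      refine (LinearMap.finrank_range_le L).trans ?_
      rw [Module.finrank_pi_fintype]
      simp only [Finset.sum_const, Finset.card_univ, Fintype.card_fin, smul_eq_mul]
      gcongr
    · rintro l hl j _ ⟨f, rfl⟩
      rw [hL, map_sum]
      refine Submodule.sum_mem _ fun i _ => ?_
      rcases Finset.mem_insert.1 hl with rfl | hl
      · have : F l j (F l i (f i)) = (F l j * F l i) (f i : H) := rfl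
        rw [this]
        by_cases hij : j = i
        · subst hij
          rw [hidem]
          refine ⟨Pi.single i (f i), ?_⟩
          rw [hL, Finset.sum_eq_single i]
          · simp
          · intro b _ hb
            simp [Pi.single_eq_of_ne hb]
          · simp
        · rw [horth l j i hij]
          simp
      · have : F l j (F k i (f i)) = F k i (F l j (f i : H)) :=
          DFunLike.congr_fun (hcomm l k j i).eq (f i : H)
        rw [this]
        refine ⟨Pi.single i ⟨F l j (f i), hinv l hl j _ (f i).2⟩, ?_⟩
        rw [hL, Finset.sum_eq_single i]
        · simp
        · intro b _ hb
          simp [Pi.single_eq_of_ne hb]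
        · simp

/-- Elements of the algebra generated by `τ` are approximated by operators leaving invariant any
subspace that is invariant under operators close to the components of `τ`. -/
theorem exists_invariant_approx {n : ℕ} (τ : Fin n → H →L[ℂ] H) {a : H →L[ℂ] H}
    (ha : a ∈ Algebra.adjoin ℂ (Set.range τ)) :
    ∀ ε > 0, ∃ δ > 0, ∀ D : Fin n → H →L[ℂ] H, (∀ k, ‖τ k - D k‖ ≤ δ) →
      ∀ V : Submodule ℂ H, (∀ k, ∀ x ∈ V, D k x ∈ V) →
        ∃ d : H →L[ℂ] H, (∀ x ∈ V, d x ∈ V) ∧ ‖a - d‖ ≤ ε := by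
  induction ha using Algebra.adjoin_induction with
  | mem a ha =>
    obtain ⟨k, rfl⟩ := ha
    exact fun ε hε => ⟨ε, hε, fun D hD V hV => ⟨D k, hV k, hD k⟩⟩
  | algebraMap c =>
    refine fun ε hε => ⟨1, one_pos, fun D hD V hV => ⟨algebraMap ℂ _ c, fun x hx => ?_, ?_⟩⟩
    · simpa [Algebra.algebraMap_eq_smul_one] using V.smul_mem c hx
    · simpa using hε.le
  | add a b _ _ iha ihb =>
    intro ε hε
    obtain ⟨δ, hδ, h⟩ := iha (ε / 2) (by positivity)
    obtain ⟨δ', hδ', h'⟩ := ihb (ε / 2) (by positivity)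
    refine ⟨min δ δ', lt_min hδ hδ', fun D hD V hV => ?_⟩
    obtain ⟨d, hd, hn⟩ := h D (fun k => (hD k).trans (min_le_left _ _)) V hV
    obtain ⟨d', hd', hn'⟩ := h' D (fun k => (hD k).trans (min_le_right _ _)) V hV
    refine ⟨d + d', fun x hx => V.add_mem (hd x hx) (hd' x hx), ?_⟩
    rw [add_sub_add_comm]
    exact (norm_add_le _ _).trans (by linarith)
  | mul a b _ _ iha ihb =>
    intro ε hε
    set K := ‖a‖ + ‖b‖ + 1
    have hK : 1 ≤ K := by
      have := norm_nonneg a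
      have := norm_nonneg b
      simp only [K]; linarith
    -- The bound by 1 keeps `‖d‖ ≤ ‖a‖ + 1`, as needed in `a b - d d' = (a - d) b + d (b - d')`.
    have hε' : 0 < min 1 (ε / (2 * K)) := by positivity
    obtain ⟨δ, hδ, h⟩ := iha _ hε'
    obtain ⟨δ', hδ', h'⟩ := ihb _ hε'
    refine ⟨min δ δ', lt_min hδ hδ', fun D hD V hV => ?_⟩
    obtain ⟨d, hd, hn⟩ := h D (fun k => (hD k).trans (min_le_left _ _)) V hV
    obtain ⟨d', hd', hn'⟩ := h' D (fun k => (hD k).trans (min_le_right _ _)) V hV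
    refine ⟨d * d', fun x hx => hd _ (hd' x hx), ?_⟩
    have h1 : a * b - d * d' = (a - d) * b + d * (b - d') := by noncomm_ring
    have h2 : ‖d‖ ≤ K := by
      have : ‖d‖ ≤ ‖a‖ + ‖a - d‖ := by
        rw [norm_sub_rev]
        simpa using norm_add_le a (d - a)
      have := hn.trans (min_le_left _ _)
      have := norm_nonneg b
      simp only [K]; linarith
    have h3 : ‖b‖ ≤ K := by
      have := norm_nonneg a
      simp only [K]; linarith
    have h4 := hn.trans (min_le_right _ _)
    have h5 := hn'.trans (min_le_right _ _)
    rw [h1]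
    calc _ ≤ ‖a - d‖ * ‖b‖ + ‖d‖ * ‖b - d'‖ :=
          (norm_add_le _ _).trans (add_le_add (norm_mul_le _ _) (norm_mul_le _ _))
      _ ≤ ε / (2 * K) * K + K * (ε / (2 * K)) := by gcongr
      _ = ε := by field_simp; ring

/-- By cyclicity `x` is close to some `a ξ`, and `a` is close to an operator `d` preserving `V`.
Then `d ξ` lies in `V` and is killed by `1 - V.starProjection`. -/
theorem exists_small_projection_error {n : ℕ} {τ : Fin n → H →L[ℂ] H} {ξ : H}
    (hξ : IsCyclicVector τ ξ) (s : Finset H) {ε : ℝ} (hε : 0 < ε) :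
    ∃ δ > 0, ∀ D : Fin n → H →L[ℂ] H, (∀ k, ‖τ k - D k‖ ≤ δ) →
      ∀ V : Submodule ℂ H, ∀ _ : V.HasOrthogonalProjection, ξ ∈ V →
        (∀ k, ∀ x ∈ V, D k x ∈ V) → ∀ x ∈ s, ‖(1 - V.starProjection) x‖ ≤ ε := by
  classical
  induction s using Finset.induction_on with
  | empty => exact ⟨1, one_pos, by simp⟩
  | insert x s _ ih =>
    obtain ⟨δ, hδ, h⟩ := ih
    obtain ⟨_, hax, a, ha, rfl⟩ := Metric.dense_iff.1 hξ x (ε / 2) (by positivity)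
    obtain ⟨δ', hδ', h'⟩ := exists_invariant_approx τ ha (ε / (2 * (‖ξ‖ + 1))) (by positivity)
    refine ⟨min δ δ', lt_min hδ hδ', fun D hD V hVp hξV hV y hy => ?_⟩
    rcases Finset.mem_insert.1 hy with rfl | hy
    · obtain ⟨d, hd, hn⟩ := h' D (fun k => (hD k).trans (min_le_right _ _)) V hV
      have h1 : (1 - V.starProjection) y = (1 - V.starProjection) (y - d ξ) := by
        have : V.starProjection (d ξ) = d ξ := V.starProjection_eq_self_iff.2 (hd ξ hξV)
        simp [this]
      have h2 : ‖(1 - V.starProjection : H →L[ℂ] H)‖ ≤ 1 := by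
        rw [← V.starProjection_orthogonal']
        exact Submodule.starProjection_norm_le _
      have h3 : ‖a ξ - d ξ‖ ≤ ε / 2 :=
        calc _ = ‖(a - d) ξ‖ := rfl
          _ ≤ ε / (2 * (‖ξ‖ + 1)) * ‖ξ‖ := ContinuousLinearMap.le_of_opNorm_le _ hn ξ
          _ ≤ ε / (2 * (‖ξ‖ + 1)) * (‖ξ‖ + 1) := by gcongr; linarith
          _ = ε / 2 := by field_simp
      have h4 : ‖y - a ξ‖ < ε / 2 := by
        rw [← dist_eq_norm, dist_comm]
        exact hax
      rw [h1]
      calc _ ≤ 1 * ‖y - d ξ‖ := ContinuousLinearMap.le_of_opNorm_le _ h2 _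
        _ = ‖(y - a ξ) + (a ξ - d ξ)‖ := by rw [one_mul]; congr 1; abel
        _ ≤ ε := (norm_add_le _ _).trans (by linarith)
    · exact h D (fun k => (hD k).trans (min_le_left _ _)) V hVp hξV hV y hy

theorem hasRankLE_commutator (T : H →L[ℂ] H) (V : Submodule ℂ H) [FiniteDimensional ℂ V] :
    HasRankLE (T * V.starProjection - V.starProjection * T)
      (Module.finrank ℂ V + Module.finrank ℂ V) :=
  ((HasRankLE.starProjection V).mul_left T).sub ((HasRankLE.starProjection V).mul_right T)

/-- An operator `D` commuting with the projection can be subtracted from `T` without changing the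
commutator. -/
theorem norm_commutator_starProjection_le {T D : H →L[ℂ] H} (V : Submodule ℂ H)
    [V.HasOrthogonalProjection] (h : Commute V.starProjection D) :
    ‖T * V.starProjection - V.starProjection * T‖ ≤ 2 * ‖T - D‖ := by
  have h1 : T * V.starProjection - V.starProjection * T
      = (T - D) * V.starProjection - V.starProjection * (T - D) := by
    rw [sub_mul, mul_sub, h.eq]
    abel
  rw [h1]
  calc _ ≤ ‖T - D‖ * ‖V.starProjection‖ + ‖V.starProjection‖ * ‖T - D‖ :=
        (norm_sub_le _ _).trans (add_le_add (norm_mul_le _ _) (norm_mul_le _ _))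
    _ ≤ ‖T - D‖ * 1 + 1 * ‖T - D‖ := by
        gcongr <;> exact V.starProjection_norm_le
    _ = _ := by ring

/-- For commuting hermitian operators with a cyclic vector, projections onto spaces of dimension
`∏ N k` almost commute with the `k`-th operator up to `4 ‖τ‖ / N k`. -/
theorem exists_projection_of_cyclic {n : ℕ} {τ : Fin n → H →L[ℂ] H} (hτ : IsCommutingHermitian τ)
    {ξ : H} (hξ : IsCyclicVector τ ξ) (s : Finset H) {ε : ℝ} (hε : 0 < ε) :
    ∃ K : ℝ, ∀ N : Fin n → ℕ, (∀ k, K ≤ N k) → (∀ k, 0 < N k) →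
      ∃ V : Submodule ℂ H, ∃ _ : FiniteDimensional ℂ V, Module.finrank ℂ V ≤ ∏ k, N k ∧
        (∀ x ∈ s, ‖(1 - V.starProjection) x‖ ≤ ε) ∧
        ∀ k, ‖τ k * V.starProjection - V.starProjection * τ k‖ ≤ 2 * (2 * ‖τ‖ / N k) := by
  obtain ⟨δ, hδ, h⟩ := exists_small_projection_error hξ s hε
  -- This threshold makes every mesh `2 * ‖τ‖ / N k` at most `δ`.
  refine ⟨2 * ‖τ‖ / δ, fun N hN hN0 => ?_⟩
  choose F y hF using fun k => exists_isSpectralPartition (hτ.isSelfAdjoint k)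
    (norm_le_pi_norm τ k) (hN0 k)
  have hcomm : ∀ k l i j, Commute (F k i) (F l j) := fun k l i j =>
    (hF k).commute _ ((hF l).isSelfAdjoint j)
      ((hF l).commute _ (hτ.isSelfAdjoint k) (hτ.commute l k) j).symm i
  obtain ⟨V, hV, hξV, hdim, hinv⟩ := exists_invariant_subspace (fun k => (hF k).idem)
    (fun k => (hF k).orthogonal) (fun k => (hF k).sum_eq_one) hcomm ξ Finset.univ
  set D : Fin n → H →L[ℂ] H := fun k => ∑ i ∈ Finset.range (N k), y k i • F k i
  have hDV : ∀ k, ∀ x ∈ V, D k x ∈ V := by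
    intro k x hx
    simp only [D, sum_apply]
    refine V.sum_mem fun i _ => ?_
    exact (V.restrictScalars ℝ).smul_mem _ (hinv k (Finset.mem_univ k) i x hx)
  have hDs : ∀ k, IsSelfAdjoint (D k) := by
    intro k
    simp only [D]
    refine isSelfAdjoint_sum _ fun i _ => ?_
    exact (IsSelfAdjoint.all (y k i)).smul ((hF k).isSelfAdjoint i)
  have hDn : ∀ k, ‖τ k - D k‖ ≤ 2 * ‖τ‖ / N k := fun k => (hF k).norm_sub_le
  refine ⟨V, hV, hdim, h D (fun k => (hDn k).trans ?_) V inferInstance hξV hDV, fun k => ?_⟩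
  · have h0 : (0 : ℝ) < N k := by exact_mod_cast hN0 k
    have := hN k
    rw [div_le_iff₀ hδ] at this
    rw [div_le_iff₀ h0]
    linarith
  · have := norm_commutator_starProjection_le (T := τ k) V
      (commute_starProjection_of_invariant (hDs k) V (hDV k))
    exact this.trans (by have := hDn k; linarith)

end CyclicBound

/-- The choice `N k = ⌈φ k (onesSeq m)⌉₊` balances the two factors of the gauge estimate: the
commutator norm is of order `‖τ‖ / φ k (onesSeq m)`, and its rank is at most `2 * c₀ * m`, where
subadditivity bounds `φ k` by a multiple of `φ k (onesSeq m)`. Divergence of every `φ k (onesSeq m)`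
makes all meshes small. -/
theorem hasCyclicBound_of_tendsto {n : ℕ} (φ : Fin n → NormingFunction)
    (hφ : ∀ k, Tendsto (fun m : ℕ => φ k (onesSeq m)) atTop atTop) {B : ℝ} (hB : 0 < B)
    (hlim : Tendsto (fun m : ℕ => (m : ℝ)⁻¹ * ∏ k, φ k (onesSeq m)) atTop (𝓝 B)) :
    ∃ C : ℝ≥0, HasCyclicBound.{u} φ C := by
  -- For large `m` rounding up at most doubles each of the `n` factors, and the product of the `φ k
  -- (onesSeq m)` is at most `2 * B * m`. Hence `dim V ≤ c₀ * m`.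
  set c₀ : ℕ := ⌈2 ^ n * (2 * B)⌉₊
  -- Here 648 = 9 · 72: the 9 is lost in `quasicentralModulus_le`, and 72 = 3 · 4 · 3 · 2 comes from
  -- the last estimate below.
  refine ⟨(648 * c₀ : ℕ), ?_⟩
  intro H _ _ _ _ _ τ hτ ⟨ξ, hξ⟩
  have main := quasicentralModulus_le φ τ (c := 72 * c₀ * ‖τ‖) (by positivity) ?_
  · refine main.trans (ENNReal.ofReal_le_ofReal (le_of_eq ?_))
    push_cast
    ring
  intro s ε hε
  obtain ⟨K, hK⟩ := exists_projection_of_cyclic hτ hξ s hε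
  have e1 : ∀ᶠ m : ℕ in atTop, ∀ k, max K 1 ≤ φ k (onesSeq m) :=
    eventually_all.2 fun k => (hφ k).eventually_ge_atTop _
  have e2 : ∀ᶠ m : ℕ in atTop, (m : ℝ)⁻¹ * ∏ k, φ k (onesSeq m) ≤ 2 * B :=
    hlim.eventually_le_const (by linarith)
  obtain ⟨m, ⟨hm1, hm2⟩, hm3⟩ := ((e1.and e2).and (eventually_gt_atTop 0)).exists
  have hm0 : (0 : ℝ) < m := by exact_mod_cast hm3
  have hP1 : ∀ k, 1 ≤ φ k (onesSeq m) := fun k => (le_max_right _ _).trans (hm1 k)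
  let N : Fin n → ℕ := fun k => ⌈φ k (onesSeq m)⌉₊
  have hN1 : ∀ k, φ k (onesSeq m) ≤ N k := fun k => Nat.le_ceil _
  have hN2 : ∀ k, (N k : ℝ) ≤ 2 * φ k (onesSeq m) := fun k => by
    have := Nat.ceil_lt_add_one ((φ k).nonneg (onesSeq m))
    have := hP1 k
    simp only [N]
    linarith
  obtain ⟨V, hV, hdim, hVs, hVc⟩ := hK N
    (fun k => ((le_max_left _ _).trans (hm1 k)).trans (hN1 k))
    (fun k => Nat.ceil_pos.2 (one_pos.trans_le (hP1 k)))
  have hdim' : Module.finrank ℂ V ≤ c₀ * m := by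
    have h1 : ((∏ k, N k : ℕ) : ℝ) ≤ 2 ^ n * ∏ k, φ k (onesSeq m) := by
      push_cast
      calc _ ≤ ∏ k, (2 * φ k (onesSeq m)) :=
            Finset.prod_le_prod (fun k _ => by positivity) fun k _ => hN2 k
        _ = _ := by rw [Finset.prod_mul_distrib]; simp
    have h2 : ∏ k, φ k (onesSeq m) ≤ 2 * B * m := by
      rwa [inv_mul_le_iff₀ hm0, mul_comm] at hm2
    have h3 : ((∏ k, N k : ℕ) : ℝ) ≤ (c₀ * m : ℕ) := by
      push_cast
      calc _ ≤ 2 ^ n * (2 * B * m) := by simpa using h1.trans (by gcongr)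
        _ = 2 ^ n * (2 * B) * m := by ring
        _ ≤ c₀ * m := by gcongr; exact Nat.le_ceil _
    exact hdim.trans (by exact_mod_cast h3)
  refine ⟨_, isPosContraction_starProjection V, hVs, fun k => ?_⟩
  have h1 := (hasRankLE_commutator (τ k) V).gauge_le (φ k)
  have h2 : φ k (onesSeq (Module.finrank ℂ V + Module.finrank ℂ V))
      ≤ 3 * ((2 * c₀ : ℕ) * φ k (onesSeq m)) :=
    ((φ k).onesSeq_le (m := 2 * c₀ * m) (by linarith)).trans
      (by gcongr; exact (φ k).onesSeq_mul_le _ _)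
  have hP0 : 0 < φ k (onesSeq m) := one_pos.trans_le (hP1 k)
  have h3 : ‖τ k * V.starProjection - V.starProjection * τ k‖ ≤ 4 * ‖τ‖ / φ k (onesSeq m) := by
    refine (hVc k).trans ?_
    rw [mul_div_assoc', ← mul_assoc]
    norm_num only
    gcongr
    exact hN1 k
  refine h1.trans ?_
  calc _ ≤ 3 * (4 * ‖τ‖ / φ k (onesSeq m) * (3 * ((2 * c₀ : ℕ) * φ k (onesSeq m)))) := by
        gcongr
        exact (φ k).nonneg _
    _ = 72 * c₀ * ‖τ‖ := by
        push_cast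
        field_simp
        ring

/-! ### Weak integrals against a spectral measure, and covering by cubes -/

namespace ProjectionMeasure

variable {H : Type u} [NormedAddCommGroup H] [InnerProductSpace ℂ H] [CompleteSpace H]
variable {n : ℕ} (E : ProjectionMeasure H n)

theorem isSelfAdjoint_proj {s : Set (Fin n → ℝ)} (hs : MeasurableSet s) :
    IsSelfAdjoint (E.proj s) := (E.isStarProjection s hs).isSelfAdjoint

theorem proj_mul_self {s : Set (Fin n → ℝ)} (hs : MeasurableSet s) :
    E.proj s * E.proj s = E.proj s := (E.isStarProjection s hs).isIdempotentElem.eq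

theorem commute_proj {s t : Set (Fin n → ℝ)} (hs : MeasurableSet s) (ht : MeasurableSet t) :
    Commute (E.proj s) (E.proj t) := by
  unfold Commute SemiconjBy
  rw [← E.proj_inter s t hs ht, ← E.proj_inter t s ht hs, Set.inter_comm]

theorem inner_proj_eq {s : Set (Fin n → ℝ)} (hs : MeasurableSet s) (x : H) :
    ⟪x, E.proj s x⟫_ℂ = ((‖E.proj s x‖ ^ 2 : ℝ) : ℂ) := by
  have h : E.proj s x = E.proj s (E.proj s x) := (DFunLike.congr_fun (E.proj_mul_self hs) x).symm
  have h2 : ⟪x, E.proj s (E.proj s x)⟫_ℂ = ⟪E.proj s x, E.proj s x⟫_ℂ :=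
    (((ContinuousLinearMap.isSelfAdjoint_iff_isSymmetric).1 (E.isSelfAdjoint_proj hs)) x _).symm
  rw [h, h2, inner_self_eq_norm_sq_to_K, ← h]
  simp

theorem scalarMeasure_apply {s : Set (Fin n → ℝ)} (hs : MeasurableSet s) (x : H) :
    E.scalarMeasure x s = ENNReal.ofReal (‖E.proj s x‖ ^ 2) := by
  rw [scalarMeasure, Measure.ofMeasurable_apply s hs, E.inner_proj_eq hs, Complex.ofReal_re]

theorem scalarMeasure_univ (x : H) : E.scalarMeasure x Set.univ = ENNReal.ofReal (‖x‖ ^ 2) := by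
  rw [E.scalarMeasure_apply .univ, E.proj_univ]
  rfl

instance (x : H) : IsFiniteMeasure (E.scalarMeasure x) :=
  ⟨by rw [E.scalarMeasure_univ]; exact ENNReal.ofReal_lt_top⟩

theorem scalarMeasure_real {s : Set (Fin n → ℝ)} (hs : MeasurableSet s) (x : H) :
    (E.scalarMeasure x).real s = ‖E.proj s x‖ ^ 2 := by
  rw [Measure.real, E.scalarMeasure_apply hs, ENNReal.toReal_ofReal (by positivity)]

theorem scalarMeasure_real_univ (x : H) : (E.scalarMeasure x).real Set.univ = ‖x‖ ^ 2 := by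
  rw [E.scalarMeasure_real .univ, E.proj_univ]
  rfl

theorem scalarMeasure_proj {B : Set (Fin n → ℝ)} (hB : MeasurableSet B) (x : H) :
    E.scalarMeasure (E.proj B x) = (E.scalarMeasure x).restrict B := by
  ext s hs
  rw [E.scalarMeasure_apply hs, Measure.restrict_apply hs, E.scalarMeasure_apply (hs.inter hB),
    E.proj_inter s B hs hB]
  rfl

/-- `X = ∫ g dE`, in the weak sense. -/
structure Represents (X : H →L[ℂ] H) (g : (Fin n → ℝ) → ℝ) : Prop where
  integrable : ∀ x, Integrable g (E.scalarMeasure x)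
  integral : ∀ x, ((∫ y, g y ∂(E.scalarMeasure x) : ℝ) : ℂ) = ⟪x, X x⟫_ℂ

theorem eq_of_inner_eq {X Y : H →L[ℂ] H} (h : ∀ x, ⟪x, X x⟫_ℂ = ⟪x, Y x⟫_ℂ) : X = Y := by
  have : (X : H →ₗ[ℂ] H) = Y := (ext_inner_map _ _).1 fun x => by
    rw [← inner_conj_symm, ← inner_conj_symm ((Y : H →ₗ[ℂ] H) x)]
    exact congrArg _ (h x)
  exact ContinuousLinearMap.coe_injective this

variable {E} {X Y : H →L[ℂ] H} {f g : (Fin n → ℝ) → ℝ}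

namespace Represents

theorem unique (hX : E.Represents X g) (hY : E.Represents Y g) : X = Y :=
  eq_of_inner_eq fun x => by rw [← hX.integral, ← hY.integral]

theorem isSelfAdjoint (hX : E.Represents X g) : IsSelfAdjoint X := by
  rw [ContinuousLinearMap.isSelfAdjoint_iff_isSymmetric,
    LinearMap.isSymmetric_iff_inner_map_self_real]
  intro x
  rw [inner_conj_symm]
  change ⟪x, X x⟫_ℂ = ⟪X x, x⟫_ℂ
  rw [← inner_conj_symm (X x), ← hX.integral, Complex.conj_ofReal]

theorem add (hX : E.Represents X f) (hY : E.Represents Y g) : E.Represents (X + Y) (f + g) := by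
  refine ⟨fun x => (hX.integrable x).add (hY.integrable x), fun x => ?_⟩
  rw [add_apply, inner_add_right, ← hX.integral, ← hY.integral, ← Complex.ofReal_add]
  congr 1
  exact integral_add (hX.integrable x) (hY.integrable x)

theorem smul (hX : E.Represents X g) (c : ℝ) : E.Represents (c • X) (c • g) := by
  refine ⟨fun x => (hX.integrable x).smul c, fun x => ?_⟩
  have h1 : (c • X) x = (c : ℂ) • X x := by simp
  rw [h1, inner_smul_right, ← hX.integral, ← Complex.ofReal_mul]
  congr 1
  exact integral_smul c g

theorem zero : E.Represents 0 0 := ⟨fun x => integrable_zero _ _ _, fun x => by simp⟩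

theorem one : E.Represents 1 1 := by
  refine ⟨fun x => integrable_const _, fun x => ?_⟩
  have : ∫ y, (1 : (Fin n → ℝ) → ℝ) y ∂(E.scalarMeasure x) = ‖x‖ ^ 2 := by
    simp [E.scalarMeasure_real_univ]
  rw [this, one_apply_eq_self, inner_self_eq_norm_sq_to_K]
  simp

theorem sum {α : Type*} (s : Finset α) {X : α → H →L[ℂ] H} {g : α → (Fin n → ℝ) → ℝ}
    (h : ∀ a ∈ s, E.Represents (X a) (g a)) :
    E.Represents (∑ a ∈ s, X a) (∑ a ∈ s, g a) := by
  classical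
  induction s using Finset.induction_on with
  | empty => simpa using zero
  | insert a s ha ih =>
    rw [Finset.sum_insert ha, Finset.sum_insert ha]
    exact (h a (by simp)).add (ih fun b hb => h b (by simp [hb]))

theorem inner_proj (hX : E.Represents X g) {B : Set (Fin n → ℝ)} (hB : MeasurableSet B) (x : H) :
    ⟪x, (E.proj B * X * E.proj B) x⟫_ℂ = ((∫ y in B, g y ∂(E.scalarMeasure x) : ℝ) : ℂ) := by
  rw [← E.scalarMeasure_proj hB, hX.integral]
  exact (((ContinuousLinearMap.isSelfAdjoint_iff_isSymmetric).1 (E.isSelfAdjoint_proj hB)) x _).symm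

/-- The integral of `g` splits over `B` and its complement. As quadratic forms determine operators,
`X` is block diagonal for this splitting. -/
theorem commute_proj (hX : E.Represents X g) {B : Set (Fin n → ℝ)} (hB : MeasurableSet B) :
    Commute X (E.proj B) := by
  have h : X = E.proj B * X * E.proj B + E.proj Bᶜ * X * E.proj Bᶜ := by
    refine eq_of_inner_eq fun x => ?_
    rw [add_apply, inner_add_right, hX.inner_proj hB, hX.inner_proj hB.compl, ← Complex.ofReal_add,
      integral_add_compl hB (hX.integrable x), hX.integral]
  have h0 : E.proj B * E.proj Bᶜ = 0 := by
    rw [← E.proj_inter _ _ hB hB.compl, Set.inter_compl_self, E.proj_empty]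
  have h0' : E.proj Bᶜ * E.proj B = 0 := by
    rw [← E.proj_inter _ _ hB.compl hB, Set.compl_inter_self, E.proj_empty]
  have h1 : X * E.proj B = E.proj B * X * E.proj B := by
    conv_lhs => rw [h]
    rw [add_mul, mul_assoc (E.proj B * X), E.proj_mul_self hB, mul_assoc (E.proj Bᶜ * X), h0',
      mul_zero, add_zero]
  have h2 : E.proj B * X = E.proj B * X * E.proj B := by
    conv_lhs => rw [h]
    rw [mul_add, ← mul_assoc, ← mul_assoc, E.proj_mul_self hB, ← mul_assoc, ← mul_assoc, h0,
      zero_mul, zero_mul, add_zero]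
  exact h1.trans h2.symm

theorem mul_proj (hX : E.Represents X g) {B : Set (Fin n → ℝ)} (hB : MeasurableSet B) :
    E.Represents (X * E.proj B) (B.indicator g) := by
  refine ⟨fun x => (hX.integrable x).indicator hB, fun x => ?_⟩
  have : X * E.proj B = E.proj B * X * E.proj B := by
    rw [← (hX.commute_proj hB).eq, mul_assoc, E.proj_mul_self hB]
  rw [this, hX.inner_proj hB, integral_indicator hB]

theorem proj {B : Set (Fin n → ℝ)} (hB : MeasurableSet B) :
    E.Represents (E.proj B) (B.indicator 1) := by
  simpa using (one (E := E)).mul_proj hB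

theorem nonneg (hX : E.Represents X g) (hg : ∀ y, 0 ≤ g y) : 0 ≤ X := by
  rw [ContinuousLinearMap.nonneg_iff_isPositive, ContinuousLinearMap.isPositive_def']
  refine ⟨hX.isSelfAdjoint, fun x => ?_⟩
  rw [ContinuousLinearMap.reApplyInnerSelf_apply, ← inner_conj_symm, ← hX.integral]
  simpa using integral_nonneg hg

theorem norm_le (hX : E.Represents X g) {c : ℝ} (hc : 0 ≤ c) (hg : ∀ y, |g y| ≤ c) : ‖X‖ ≤ c := by
  rw [X.norm_eq_iSup_rayleighQuotient
    (ContinuousLinearMap.isSelfAdjoint_iff_isSymmetric.1 hX.isSelfAdjoint)]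
  refine ciSup_le fun x => ?_
  rw [ContinuousLinearMap.rayleighQuotient, ContinuousLinearMap.reApplyInnerSelf_apply,
    ← inner_conj_symm, ← hX.integral, abs_div, abs_of_nonneg (sq_nonneg ‖x‖)]
  refine div_le_of_le_mul₀ (sq_nonneg _) hc ?_
  have : |∫ y, g y ∂(E.scalarMeasure x)| ≤ c * (E.scalarMeasure x).real Set.univ := by
    rw [← Real.norm_eq_abs]
    exact norm_integral_le_of_norm_le_const (.of_forall hg)
  rw [E.scalarMeasure_real_univ] at this
  simpa using this

end Represents

theorem proj_compl {B : Set (Fin n → ℝ)} (hB : MeasurableSet B) :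
    E.proj Bᶜ = 1 - E.proj B := by
  refine (Represents.proj hB.compl).unique ?_
  have := (Represents.one (E := E)).add ((Represents.proj hB).smul (-1))
  convert this using 1
  · simp [sub_eq_add_neg]
  · ext y
    by_cases hy : y ∈ B <;> simp [hy]

theorem proj_biUnion_finset {α : Type*} (s : Finset α) {B : α → Set (Fin n → ℝ)}
    (hB : ∀ a, MeasurableSet (B a)) (hd : (s : Set α).PairwiseDisjoint B) :
    E.proj (⋃ a ∈ s, B a) = ∑ a ∈ s, E.proj (B a) := by
  refine (Represents.proj (s.measurableSet_biUnion fun a _ => hB a)).unique ?_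
  convert Represents.sum s fun a _ => Represents.proj (E := E) (hB a) using 1
  rw [Finset.indicator_biUnion s B fun a ha b hb hab => hd ha hb hab]
  ext y
  simp [Finset.sum_apply]

/-- Compact support bounds the coordinate functions almost everywhere, which supplies the
integrability that the weak formula alone does not state. -/
theorem IsSpectralMeasureOf.represents {τ : Fin n → H →L[ℂ] H} (h : E.IsSpectralMeasureOf τ)
    (j : Fin n) : E.Represents (τ j) (fun y => y j) := by
  refine ⟨fun x => ?_, h.integral_coord j⟩
  obtain ⟨K, hK, hEK⟩ := h.compact_support
  obtain ⟨R, hR⟩ := hK.isBounded.exists_norm_le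
  refine Integrable.of_bound (measurable_pi_apply j).aestronglyMeasurable R ?_
  have h0 : E.scalarMeasure x Kᶜ = 0 := by
    rw [E.scalarMeasure_apply hK.measurableSet.compl, hEK]
    simp
  rw [ae_iff]
  refine measure_mono_null (fun y hy => ?_) h0
  intro hyK
  exact hy ((norm_le_pi_norm y j).trans (hR y hyK))

/-- A spectral projection below a gap is determined by the operator. -/
theorem lowerProjection_eq_proj (hX : E.Represents X g) {S : Set (Fin n → ℝ)}
    (hS : MeasurableSet S) {t ε : ℝ} (hε : 0 < ε) (h1 : ∀ y ∈ S, g y ≤ t)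
    (h2 : ∀ y, y ∉ S → t + ε ≤ g y) : lowerProjection X t = E.proj S := by
  have hXt : E.Represents (X - algebraMap ℝ _ t) (g - fun _ => t) := by
    have := hX.add ((Represents.one (E := E)).smul (-t))
    convert this using 1
    · simp [sub_eq_add_neg, Algebra.algebraMap_eq_smul_one]
    · ext y
      simp [sub_eq_add_neg]
  set Z := X - algebraMap ℝ (H →L[ℂ] H) t with hZ
  set G := E.proj S
  have hGG : G * G = G := E.proj_mul_self hS
  have hG : IsSelfAdjoint G := E.isSelfAdjoint_proj hS
  have hZG : Commute Z G := hXt.commute_proj hS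
  set b := Z * (1 - G)
  have hbrep : E.Represents b (Sᶜ.indicator (g - fun _ => t)) := by
    have := hXt.mul_proj hS.compl
    rwa [proj_compl hS] at this
  have hgap : 0 ≤ b - ε • (1 - G) := by
    have := hbrep.add (((Represents.proj (E := E) hS.compl)).smul (-ε))
    rw [proj_compl hS] at this
    rw [sub_eq_add_neg, ← neg_smul]
    refine this.nonneg fun y => ?_
    by_cases hy : y ∈ S
    · simp [hy]
    · have := h2 y hy
      simp [hy]
      linarith
  have hb0 : 0 ≤ b := hbrep.nonneg fun y => by
    by_cases hy : y ∈ S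
    · simp [hy]
    · have := h2 y hy
      simp [hy]
      linarith
  have hc0 : 0 ≤ -(Z * G) := by
    have := (hXt.mul_proj hS).smul (-1)
    rw [neg_one_smul] at this
    refine this.nonneg fun y => ?_
    by_cases hy : y ∈ S
    · have := h1 y hy
      simp [hy]
      linarith
    · simp [hy]
  -- `Z` is the difference of the positive operators `Z (1 - G)` and `-(Z G)`, whose product is
  -- zero; such a decomposition is unique.
  have hpos : Z⁺ = b := by
    refine (CFC.posPart_negPart_unique (b := b) (c := -(Z * G)) ?_ ?_ hb0 hc0).1
    · simp only [b]
      noncomm_ring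
    · have : Z * (1 - G) * -(Z * G) = -(Z * (1 - G) * (G * Z)) := by
        rw [mul_neg, hZG.eq]
      rw [this, mul_assoc, ← mul_assoc (1 - G), sub_mul 1 G, one_mul, hGG, sub_self, zero_mul,
        mul_zero, neg_zero]
  set e := lowerProjection X t with he
  have hes : IsSelfAdjoint e := (isStarProjection_lowerProjection X t).isSelfAdjoint
  have hbe : b * e = 0 := by
    rw [← hpos]
    exact posPart_mul_lowerProjection hX.isSelfAdjoint t
  have heG : e * G = G := by
    have hbG : Z⁺ * G = 0 := by
      rw [hpos]
      simp only [b]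
      rw [mul_assoc, sub_mul 1 G, one_mul, hGG, sub_self, mul_zero]
    ext x
    exact Submodule.starProjection_eq_self_iff.2 (DFunLike.congr_fun hbG x)
  -- The gap enters here: `b ≥ ε (1 - G)` and `b e = 0` force `1 - G` to vanish on the range of `e`.
  have hGe' : (1 - G) * e = 0 := by
    have hGp : IsStarProjection (1 - G) := (E.isStarProjection S hS).one_sub
    have h3 := hes.conjugate_nonneg hgap
    have h4 : e * (b - ε • (1 - G)) * e = -(ε • (star ((1 - G) * e) * ((1 - G) * e))) := by
      rw [star_mul, hes.star_eq, hGp.isSelfAdjoint.star_eq, mul_assoc, sub_mul, hbe, zero_sub,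
        mul_neg, smul_mul_assoc, mul_smul_comm]
      congr 2
      rw [mul_assoc, ← mul_assoc (1 - G) (1 - G), hGp.isIdempotentElem.eq]
    rw [h4] at h3
    have h5 : 0 ≤ ε • (star ((1 - G) * e) * ((1 - G) * e)) :=
      smul_nonneg hε.le (star_mul_self_nonneg _)
    have h6 := le_antisymm (neg_nonneg.1 h3) h5
    rw [smul_eq_zero] at h6
    exact (CStarRing.star_mul_self_eq_zero_iff _).1 (h6.resolve_left hε.ne')
  have hGe : G * e = e := by
    rw [sub_mul, one_mul, sub_eq_zero] at hGe'
    exact hGe'.symm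
  have := congrArg star heG
  rw [star_mul, hes.star_eq, hG.star_eq, hGe] at this
  exact this

/-- The measurable sets whose spectral projection commutes with `P` are closed under finite
intersections. -/
theorem commute_proj_iInter {P : H →L[ℂ] H} {m : ℕ} {S : Fin m → Set (Fin n → ℝ)}
    (hS : ∀ k, MeasurableSet (S k)) (h : ∀ k, Commute P (E.proj (S k))) :
    Commute P (E.proj (⋂ k, S k)) := by
  have key : ∀ s : Finset (Fin m), Commute P (E.proj (⋂ k ∈ s, S k)) := by
    classical
    intro s
    induction s using Finset.induction_on with
    | empty => simp [E.proj_univ]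
    | insert a s _ ih =>
      rw [Finset.set_biInter_insert, E.proj_inter _ _ (hS a)
        (s.measurableSet_biInter fun k _ => hS k)]
      exact (h a).mul_right ih
  simpa using key Finset.univ

open BoxIntegral in
/-- A vector in the range of a spectral projection of a null set is almost carried by a few small
cubes. -/
theorem exists_cubes {N : Set (Fin n → ℝ)} (hN0 : volume N = 0)
    (hN : E.proj Nᶜ = 0) (hNm : MeasurableSet N) (v : H) {η θ : ℝ} (hη : 0 < η) (hθ : 0 < θ) :
    ∀ᶠ p : ℕ in atTop, ∀ _ : NeZero p, ∃ J : Finset (Fin n → ℤ), (J.card : ℝ) ≤ (η * p) ^ n ∧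
      ‖v - ∑ ν ∈ J, E.proj (unitPartition.box p ν) v‖ ≤ θ := by
  obtain ⟨U, hNU, hUo, hUv⟩ := Set.exists_isOpen_lt_of_lt N (ENNReal.ofReal (η ^ n))
    (by rw [hN0]; simpa using pow_pos hη n)
  have hUtop : volume U ≠ ⊤ := (hUv.trans ENNReal.ofReal_lt_top).ne
  -- The boundary layer of `U` of width `1 / p`. Since `U` is open, these layers shrink to the empty
  -- set, so their scalar measure tends to zero.
  let A : ℕ → Set (Fin n → ℝ) := fun p => U ∩ {y | Metric.infEDist y Uᶜ ≤ (p : ℝ≥0∞)⁻¹}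
  have hA : ∀ p, MeasurableSet (A p) := fun p =>
    hUo.measurableSet.inter (measurableSet_le Metric.continuous_infEDist.measurable measurable_const)
  have hAlim : Tendsto (fun p => E.scalarMeasure v (A p)) atTop (𝓝 0) := by
    rw [← measure_empty (μ := E.scalarMeasure v)]
    refine tendsto_measure_of_tendsto_indicator atTop hA .univ (measure_ne_top _ _)
      (.of_forall fun _ => Set.subset_univ _) fun y => ?_
    by_cases hy : y ∈ U
    · have hpos : 0 < Metric.infEDist y Uᶜ := by
        rw [Metric.infEDist_pos_iff_notMem_closure, hUo.isClosed_compl.closure_eq]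
        simpa using hy
      filter_upwards [ENNReal.tendsto_inv_nat_nhds_zero.eventually_lt_const hpos] with p hp
      simp only [A, Set.mem_inter_iff, Set.mem_ofPred_eq, Set.mem_empty_iff_false, iff_false,
        not_and, not_le]
      exact fun _ => hp
    · exact .of_forall fun p => by simp [A, hy]
  have hθ2 : (0 : ℝ≥0∞) < ENNReal.ofReal (θ ^ 2) := by simpa using pow_pos hθ 2
  filter_upwards [hAlim.eventually_lt_const hθ2] with p hp hp0
  have hp1 : (0 : ℝ) < p := by exact_mod_cast hp0.pos
  have hfin := unitPartition.setFinite_index p hUo.measurableSet.nullMeasurableSet hUtop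
  set J := hfin.toFinset
  have hJ : ∀ ν ∈ J, (unitPartition.box p ν : Set (Fin n → ℝ)) ⊆ U := fun ν hν =>
    hfin.mem_toFinset.1 hν
  have hbm : ∀ ν : Fin n → ℤ, MeasurableSet (unitPartition.box p ν : Set (Fin n → ℝ)) := fun ν =>
    (unitPartition.box p ν).measurableSet_coe
  have hdisj : (J : Set (Fin n → ℤ)).PairwiseDisjoint
      fun ν => (unitPartition.box p ν : Set (Fin n → ℝ)) := fun ν _ ν' _ h =>
    unitPartition.disjoint.1 h
  refine ⟨J, ?_, ?_⟩
  · have h1 : volume (⋃ ν ∈ J, (unitPartition.box p ν : Set (Fin n → ℝ)))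
        ≤ ENNReal.ofReal (η ^ n) :=
      (measure_mono (Set.iUnion₂_subset hJ)).trans hUv.le
    rw [measure_biUnion_finset hdisj fun ν _ => hbm ν] at h1
    simp only [unitPartition.volume_box, Finset.sum_const, Fintype.card_fin, nsmul_eq_mul] at h1
    have h2 : (J.card : ℝ≥0∞) * (1 / (p : ℝ≥0∞) ^ n) = ENNReal.ofReal (J.card * (1 / p ^ n)) := by
      rw [ENNReal.ofReal_mul (by positivity), ENNReal.ofReal_div_of_pos (by positivity),
        ENNReal.ofReal_pow hp1.le]
      simp
    rw [h2, ENNReal.ofReal_le_ofReal_iff (by positivity), mul_one_div,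
      div_le_iff₀ (by positivity)] at h1
    rwa [mul_pow]
  · set F := ⋃ ν ∈ J, (unitPartition.box p ν : Set (Fin n → ℝ))
    have hF : MeasurableSet F := J.measurableSet_biUnion fun ν _ => hbm ν
    have h1 : v - ∑ ν ∈ J, E.proj (unitPartition.box p ν) v = E.proj Fᶜ v := by
      rw [proj_compl hF, proj_biUnion_finset J hbm hdisj]
      simp [sum_apply]
    -- If the cube of a point of `N` is not among those contained in `U`, it meets the complement of
    -- `U`. As cubes have diameter at most `1 / p` in the sup metric, the point is in the boundary
    -- layer.
    have hsub : Fᶜ ⊆ Nᶜ ∪ A p := by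
      intro y hy
      by_cases hyN : y ∈ N
      · refine Or.inr ⟨hNU hyN, ?_⟩
        by_contra hlt
        simp only [Set.mem_ofPred_eq, not_le] at hlt
        refine hy (Set.mem_biUnion (x := unitPartition.index p y) (hfin.mem_toFinset.2 ?_)
          (unitPartition.mem_box_iff_index.2 rfl))
        intro z hz
        by_contra hzU
        have hyb : y ∈ unitPartition.box p (unitPartition.index p y) :=
          unitPartition.mem_box_iff_index.2 rfl
        rw [Box.mem_coe, unitPartition.mem_box_iff] at hz
        rw [unitPartition.mem_box_iff] at hyb
        have hd : dist y z ≤ (p : ℝ)⁻¹ := by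
          rw [dist_pi_le_iff (by positivity)]
          intro i
          have h3 := hz i
          have h4 := hyb i
          rw [add_div, one_div] at h3 h4
          rw [Real.dist_eq, abs_le]
          constructor <;> linarith
        have h5 : edist y z ≤ (p : ℝ≥0∞)⁻¹ := by
          rw [edist_dist]
          refine (ENNReal.ofReal_le_ofReal hd).trans (le_of_eq ?_)
          rw [ENNReal.ofReal_inv_of_pos hp1]
          simp
        exact absurd ((Metric.infEDist_le_edist_of_mem hzU).trans h5) (not_le.2 hlt)
      · exact Or.inl hyN
    have h2 : ENNReal.ofReal (‖E.proj Fᶜ v‖ ^ 2) ≤ ENNReal.ofReal (θ ^ 2) := by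
      rw [← E.scalarMeasure_apply hF.compl]
      refine (measure_mono hsub).trans ((measure_union_le _ _).trans ?_)
      rw [E.scalarMeasure_apply hNm.compl, hN]
      simpa using hp.le
    rw [ENNReal.ofReal_le_ofReal_iff (by positivity)] at h2
    rw [h1]
    exact (pow_le_pow_iff_left₀ (norm_nonneg _) hθ.le two_ne_zero).1 h2

end ProjectionMeasure

/-! ### Applying the cyclic bound on a cyclic subspace -/

section CyclicSubspace

variable {H : Type u} [NormedAddCommGroup H] [InnerProductSpace ℂ H] [CompleteSpace H]
variable {n : ℕ}

/-- The closed subspace generated by `w` under the algebra generated by the components of `X`. -/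
noncomputable def cyclicSubspace (X : Fin n → H →L[ℂ] H) (w : H) : Submodule ℂ H :=
  ((Subalgebra.toSubmodule (Algebra.adjoin ℂ (Set.range X))).map
    (ContinuousLinearMap.apply ℂ H w : (H →L[ℂ] H) →ₗ[ℂ] H)).topologicalClosure

instance (X : Fin n → H →L[ℂ] H) (w : H) : CompleteSpace (cyclicSubspace X w) :=
  (Submodule.isClosed_topologicalClosure _).completeSpace_coe

theorem mem_cyclicSubspace {X : Fin n → H →L[ℂ] H} {w : H} {a : H →L[ℂ] H}
    (ha : a ∈ Algebra.adjoin ℂ (Set.range X)) : a w ∈ cyclicSubspace X w :=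
  Submodule.le_topologicalClosure _ ⟨a, ha, rfl⟩

theorem self_mem_cyclicSubspace (X : Fin n → H →L[ℂ] H) (w : H) : w ∈ cyclicSubspace X w :=
  mem_cyclicSubspace (a := 1) (one_mem _)

theorem map_mem_cyclicSubspace {X : Fin n → H →L[ℂ] H} {w : H} (k : Fin n) :
    ∀ x ∈ cyclicSubspace X w, X k x ∈ cyclicSubspace X w := by
  intro x hx
  refine map_mem_closure (X k).continuous hx ?_
  rintro _ ⟨a, ha, rfl⟩
  exact ⟨X k * a, Subalgebra.mul_mem _ (Algebra.subset_adjoin ⟨k, rfl⟩) ha, rfl⟩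

theorem commute_cyclicSubspace_starProjection {X : Fin n → H →L[ℂ] H}
    (hX : IsCommutingHermitian X) (w : H) (k : Fin n) :
    Commute (cyclicSubspace X w).starProjection (X k) :=
  commute_starProjection_of_invariant (hX.isSelfAdjoint k) _ (map_mem_cyclicSubspace k)

section Compression

variable (K : Submodule ℂ H) [CompleteSpace K]

/-- The compression of an operator to a closed subspace. -/
noncomputable def compression (T : H →L[ℂ] H) : K →L[ℂ] K :=
  K.orthogonalProjectionOnto ∘L T ∘L K.subtypeL

variable {K}

theorem coe_compression {T : H →L[ℂ] H} (h : ∀ x ∈ K, T x ∈ K) (x : K) :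
    (compression K T x : H) = T x :=
  K.starProjection_eq_self_iff.2 (h x x.2)

theorem isSelfAdjoint_compression {T : H →L[ℂ] H} (hT : IsSelfAdjoint T) :
    IsSelfAdjoint (compression K T) := by
  rw [ContinuousLinearMap.isSelfAdjoint_iff_isSymmetric] at hT ⊢
  intro x y
  have h1 : ∀ (z : H) (y : K), ⟪K.orthogonalProjectionOnto z, y⟫_ℂ = ⟪z, (y : H)⟫_ℂ := fun z y => by
    simp
  have h2 : ⟪compression K T x, y⟫_ℂ = ⟪T x, (y : H)⟫_ℂ := h1 _ _
  have h3 : ⟪x, compression K T y⟫_ℂ = ⟪(x : H), T y⟫_ℂ := by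
    rw [← inner_conj_symm, ← inner_conj_symm (x : H)]
    exact congrArg _ (h1 _ _)
  exact h2.trans ((hT x y).trans h3.symm)

theorem norm_compression_le (T : H →L[ℂ] H) : ‖compression K T‖ ≤ ‖T‖ := by
  refine ContinuousLinearMap.opNorm_le_bound _ (norm_nonneg _) fun x => ?_
  calc ‖compression K T x‖ ≤ 1 * ‖T x‖ :=
        ContinuousLinearMap.le_of_opNorm_le _ K.orthogonalProjectionOnto_norm_le _
    _ ≤ ‖T‖ * ‖x‖ := by rw [one_mul]; exact T.le_opNorm _

end Compression

theorem exists_compression_of_mem_adjoin {X : Fin n → H →L[ℂ] H} {K : Submodule ℂ H}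
    [CompleteSpace K] (hK : ∀ k, ∀ x ∈ K, X k x ∈ K) {a : H →L[ℂ] H}
    (ha : a ∈ Algebra.adjoin ℂ (Set.range X)) :
    ∃ b ∈ Algebra.adjoin ℂ (Set.range fun k => compression K (X k)),
      ∀ x : K, (b x : H) = a x := by
  induction ha using Algebra.adjoin_induction with
  | mem a ha =>
    obtain ⟨k, rfl⟩ := ha
    exact ⟨_, Algebra.subset_adjoin ⟨k, rfl⟩, coe_compression (hK k)⟩
  | algebraMap c =>
    exact ⟨algebraMap ℂ _ c, Subalgebra.algebraMap_mem _ c, fun x => by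
      simp [Algebra.algebraMap_eq_smul_one]⟩
  | add a a' _ _ ha ha' =>
    obtain ⟨b, hb, h⟩ := ha
    obtain ⟨b', hb', h'⟩ := ha'
    exact ⟨b + b', add_mem hb hb', fun x => by simp [h, h']⟩
  | mul a a' _ _ ha ha' =>
    obtain ⟨b, hb, h⟩ := ha
    obtain ⟨b', hb', h'⟩ := ha'
    exact ⟨b * b', mul_mem hb hb', fun x => by
      rw [mul_apply_eq_comp, mul_apply_eq_comp, h, h']⟩

theorem isCommutingHermitian_compression {X : Fin n → H →L[ℂ] H} (hX : IsCommutingHermitian X)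
    {K : Submodule ℂ H} [CompleteSpace K] (hK : ∀ k, ∀ x ∈ K, X k x ∈ K) :
    IsCommutingHermitian fun k => compression K (X k) := by
  refine ⟨fun k => isSelfAdjoint_compression (hX.isSelfAdjoint k), fun i j => ?_⟩
  ext x
  rw [mul_apply_eq_comp, mul_apply_eq_comp, coe_compression (hK i), coe_compression (hK j),
    coe_compression (hK j), coe_compression (hK i)]
  exact DFunLike.congr_fun (hX.commute i j).eq (x : H)

theorem isCyclicVector_compression (X : Fin n → H →L[ℂ] H) (w : H) :
    IsCyclicVector (fun k => compression (cyclicSubspace X w) (X k))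
      ⟨w, self_mem_cyclicSubspace X w⟩ := by
  refine Metric.dense_iff.2 fun x r hr => ?_
  obtain ⟨_, ⟨a, ha, rfl⟩, hax⟩ := Metric.mem_closure_iff.1 x.2 r hr
  obtain ⟨b, hb, h⟩ := exists_compression_of_mem_adjoin
    (map_mem_cyclicSubspace (X := X) (w := w)) ha
  refine ⟨b ⟨w, self_mem_cyclicSubspace X w⟩, ?_, b, hb, rfl⟩
  rw [Metric.mem_ball, dist_comm, Subtype.dist_eq, h]
  exact hax

/-- The tuple `X` need not be cyclic on `H`, but its restriction to the reducing subspace generated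
by `w` is. A contraction found there is extended by zero; the commutator is extended in the same
way, at the cost of the ideal constant 9. -/
theorem exists_posContraction_cyclicSubspace [TopologicalSpace.SeparableSpace H]
    {φ : Fin n → NormingFunction} {C : ℝ≥0} (hC : HasCyclicBound.{u} φ C)
    {X : Fin n → H →L[ℂ] H} (hX : IsCommutingHermitian X) (w : H) {c : ℝ} (hc : 0 < c)
    (hcX : C * ‖X‖ < c) {W : Submodule ℂ H} [FiniteDimensional ℂ W]
    (hW : W ≤ cyclicSubspace X w) :
    ∃ A : H →L[ℂ] H, IsPosContraction A ∧ (∀ x ∈ W, A x = x) ∧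
      ∀ j, (φ j).gauge (X j * A - A * X j) ≤ 9 * c := by
  set K := cyclicSubspace X w with hKdef
  have hinv : ∀ k, ∀ x ∈ K, X k x ∈ K := map_mem_cyclicSubspace
  let σ : Fin n → K →L[ℂ] K := fun k => compression K (X k)
  let W' : Submodule ℂ K := W.comap K.subtype
  have hW'fin : FiniteDimensional ℂ W' :=
    Module.Finite.of_injective ((K.subtype ∘ₗ W'.subtype).codRestrict W fun x => x.2) (by
      intro x y hxy
      have := congrArg Subtype.val hxy
      exact Subtype.ext (Subtype.ext this))
  obtain ⟨A, hA, hAW, hAc⟩ : ∃ A : K →L[ℂ] K, IsPosContraction A ∧ (∀ x ∈ W', A x = x) ∧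
      ∀ j, (φ j).gauge (σ j * A - A * σ j) ≤ c := by
    -- The assumed bound concerns infinite dimensional spaces only. On a finite dimensional `K` the
    -- identity works, with zero commutators.
    by_cases hfd : FiniteDimensional ℂ K
    · refine ⟨1, .of_nonneg_of_le_one zero_le_one le_rfl ?_, fun x _ => rfl, fun j => ?_⟩
      · exact .of_range_le ⊤ fun x => trivial
      · rw [mul_one, one_mul, sub_self, NormingFunction.gauge_zero]
        exact hc.le
    · have h := hC K hfd σ (isCommutingHermitian_compression hX hinv)
        ⟨_, isCyclicVector_compression X w⟩
      refine exists_posContraction_of_quasicentralModulus_lt hc (h.trans_lt ?_) W'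
      rw [ENNReal.ofReal_lt_ofReal_iff hc]
      refine lt_of_le_of_lt ?_ hcX
      gcongr
      exact (pi_norm_le_iff_of_nonneg (norm_nonneg _)).2 fun k =>
        (norm_compression_le _).trans (norm_le_pi_norm X k)
  let ι : K →L[ℂ] H := K.subtypeL
  let π : H →L[ℂ] K := K.orthogonalProjectionOnto
  have hι : ‖ι‖ ≤ 1 := K.norm_subtypeL_le
  have hπ : ‖π‖ ≤ 1 := K.orthogonalProjectionOnto_norm_le
  have hadj : ContinuousLinearMap.adjoint ι = π := K.adjoint_subtypeL
  refine ⟨ι ∘L A ∘L π, ⟨?_, ?_, (hA.finiteRank.comp_right π).comp_left ι⟩, fun x hx => ?_,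
    fun j => ?_⟩
  · rw [← hadj, ContinuousLinearMap.nonneg_iff_isPositive]
    exact ((ContinuousLinearMap.nonneg_iff_isPositive _).1 hA.nonneg).conj_adjoint ι
  · calc _ ≤ ‖ι‖ * (‖A‖ * ‖π‖) := (ContinuousLinearMap.opNorm_comp_le _ _).trans
          (by gcongr; exact ContinuousLinearMap.opNorm_comp_le _ _)
      _ ≤ 1 * (1 * 1) := by gcongr; exact hA.norm_le
      _ = 1 := by norm_num
  · have hxK : x ∈ K := hW hx
    have h1 : π x = ⟨x, hxK⟩ := by
      apply Subtype.ext
      exact K.starProjection_eq_self_iff.2 hxK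
    change ((A (π x) : K) : H) = x
    rw [h1, hAW ⟨x, hxK⟩ hx]
  · have h1 : ∀ x : K, X j (ι x) = ι (σ j x) := fun x => (coe_compression (hinv j) x).symm
    have h2 : ∀ x : H, π (X j x) = σ j (π x) := fun x => by
      apply Subtype.ext
      rw [coe_compression (hinv j)]
      exact DFunLike.congr_fun (commute_cyclicSubspace_starProjection hX w j).eq x
    have h3 : X j * (ι ∘L A ∘L π) - (ι ∘L A ∘L π) * X j
        = ι ∘L (σ j * A - A * σ j) ∘L π := by
      ext x
      change X j (ι (A (π x))) - ι (A (π (X j x))) = ι (σ j (A (π x)) - A (σ j (π x)))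
      rw [h1, h2, map_sub]
    rw [h3]
    exact ((φ j).gauge_comp_comp_le (hA.finiteRank.commutator (σ j)) hι hπ).trans
      (by gcongr; exact hAc j)

end CyclicSubspace

/-! ### Part (b): rearranging the cubes of a singular spectral measure -/

section Singular

variable {H : Type u} [NormedAddCommGroup H] [InnerProductSpace ℂ H] [CompleteSpace H]
variable {n : ℕ} {E : ProjectionMeasure H n}

theorem ProjectionMeasure.sum_norm_sq_proj_le {α : Type*} (s : Finset α)
    {B : α → Set (Fin n → ℝ)} (hB : ∀ a, MeasurableSet (B a))
    (hd : (s : Set α).PairwiseDisjoint B) (x : H) :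
    ∑ a ∈ s, ‖E.proj (B a) x‖ ^ 2 ≤ ‖x‖ ^ 2 := by
  rw [← E.scalarMeasure_real_univ]
  simp only [← E.scalarMeasure_real (hB _)]
  rw [← measureReal_biUnion_finset hd fun a _ => hB a]
  exact measureReal_mono (Set.subset_univ _)

/-- The block diagonal part of a finite rank positive contraction. -/
theorem ProjectionMeasure.isPosContraction_pinch {α : Type*} (s : Finset α)
    {B : α → Set (Fin n → ℝ)} (hB : ∀ a, MeasurableSet (B a))
    (hd : (s : Set α).PairwiseDisjoint B) {A : H →L[ℂ] H} (hA : IsPosContraction A) :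
    IsPosContraction (∑ a ∈ s, E.proj (B a) * A * E.proj (B a)) := by
  refine .of_nonneg_of_le_one (Finset.sum_nonneg fun a _ =>
    (E.isSelfAdjoint_proj (hB a)).conjugate_nonneg hA.nonneg) ?_
    (.sum fun a _ => (hA.finiteRank.mul_left _).mul_right _)
  calc _ ≤ ∑ a ∈ s, E.proj (B a) := Finset.sum_le_sum fun a _ => by
        have := (E.isSelfAdjoint_proj (hB a)).conjugate_le_conjugate hA.le_one
        rwa [mul_one, E.proj_mul_self (hB a)] at this
    _ = E.proj (⋃ a ∈ s, B a) := (ProjectionMeasure.proj_biUnion_finset s hB hd).symm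
    _ ≤ 1 := (E.isStarProjection _ (s.measurableSet_biUnion fun a _ => hB a)).le_one

/-- Disjoint spectral projections satisfy the square-sum bounds of `gauge_sum_comp_le`, so the
constant does not depend on the number of blocks. -/
theorem ProjectionMeasure.gauge_pinch_le (Φ : NormingFunction) {α : Type*} (s : Finset α)
    {B : α → Set (Fin n → ℝ)} (hB : ∀ a, MeasurableSet (B a))
    (hd : (s : Set α).PairwiseDisjoint B) {T : H →L[ℂ] H} (hT : IsFiniteRank T) :
    Φ.gauge (∑ a ∈ s, E.proj (B a) * T * E.proj (B a)) ≤ 9 * Φ.gauge T := by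
  have h1 := E.sum_norm_sq_proj_le s hB hd
  have h2 : ∀ x, ∑ a ∈ s, ‖(E.proj (B a)).adjoint x‖ ^ 2 ≤ ‖x‖ ^ 2 := fun x => by
    have : ∀ a, (E.proj (B a)).adjoint = E.proj (B a) := fun a => E.isSelfAdjoint_proj (hB a)
    simp only [this]
    exact h1 x
  exact Φ.gauge_sum_comp_le hT s (fun a => E.proj (B a)) (fun a => E.proj (B a)) h1 h2 h1 h2

/-- The rearranged tuple: on the part of the spectrum in `B ν` the operator `τ k` is translated by
`r ν k`. -/
noncomputable def ProjectionMeasure.rearrange {α : Type*} (E : ProjectionMeasure H n)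
    (τ : Fin n → H →L[ℂ] H) (J : Finset α) (B : α → Set (Fin n → ℝ)) (r : α → Fin n → ℝ)
    (k : Fin n) : H →L[ℂ] H :=
  ∑ ν ∈ J, (τ k + r ν k • 1) * E.proj (B ν)

section Rearrange

variable {τ : Fin n → H →L[ℂ] H} {α : Type*} {J : Finset α} {B : α → Set (Fin n → ℝ)}
  {r : α → Fin n → ℝ} (hE : E.IsSpectralMeasureOf τ) (hB : ∀ a, MeasurableSet (B a))
include hE hB

theorem ProjectionMeasure.represents_rearrange (k : Fin n) :
    E.Represents (E.rearrange τ J B r k)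
      (∑ ν ∈ J, (B ν).indicator ((fun y => y k) + r ν k • 1)) :=
  .sum J fun ν _ => ((hE.represents k).add (ProjectionMeasure.Represents.one.smul _)).mul_proj (hB ν)

theorem ProjectionMeasure.isCommutingHermitian_rearrange (hτ : IsCommutingHermitian τ) :
    IsCommutingHermitian (E.rearrange τ J B r) := by
  refine ⟨fun k => (represents_rearrange hE hB k).isSelfAdjoint, fun j k => ?_⟩
  have h1 : ∀ (k : Fin n) (c : ℝ) (T : H →L[ℂ] H), Commute (τ k) T →
      Commute (τ k + c • 1) T := fun k c T h =>
    h.add_left ((Commute.one_left T).smul_left c)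
  have h2 : ∀ k ν, Commute (τ k) (E.proj (B ν)) := fun k ν => (hE.represents k).commute_proj (hB ν)
  refine Commute.sum_left _ _ _ fun ν _ => Commute.sum_right _ _ _ fun ν' _ => ?_
  refine Commute.mul_left (Commute.mul_right ?_ (h1 _ _ _ (h2 _ _)))
    (Commute.mul_right (h1 _ _ _ (h2 _ _)).symm (E.commute_proj (hB _) (hB _)))
  exact h1 _ _ _ (h1 _ _ _ (hτ.commute k j)).symm

/-- On each block the two tuples differ by a scalar, which drops out of the commutator. Translating
blocks is therefore free for block diagonal operators. -/
theorem ProjectionMeasure.commutator_pinch (hd : (J : Set α).PairwiseDisjoint B) (A : H →L[ℂ] H)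
    (k : Fin n) :
    τ k * (∑ ν ∈ J, E.proj (B ν) * A * E.proj (B ν))
        - (∑ ν ∈ J, E.proj (B ν) * A * E.proj (B ν)) * τ k
      = ∑ ν ∈ J, E.proj (B ν) * (E.rearrange τ J B r k * A - A * E.rearrange τ J B r k)
          * E.proj (B ν) := by
  classical
  rw [Finset.mul_sum, Finset.sum_mul, ← Finset.sum_sub_distrib]
  refine Finset.sum_congr rfl fun ν hν => ?_
  set X := E.rearrange τ J B r k
  set P := E.proj (B ν)
  have hPτ : Commute (τ k) P := (hE.represents k).commute_proj (hB ν)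
  have hXP : X * P = (τ k + r ν k • 1) * P := by
    simp only [X, rearrange]
    rw [Finset.sum_mul, Finset.sum_eq_single_of_mem ν hν]
    · rw [mul_assoc, E.proj_mul_self (hB ν)]
    · intro ν' hν' hne
      rw [mul_assoc, ← E.proj_inter _ _ (hB ν') (hB ν), (hd hν' hν hne).inter_eq, E.proj_empty,
        mul_zero]
  have hPX : P * X = P * (τ k + r ν k • 1) := by
    rw [← ((represents_rearrange hE hB k).commute_proj (hB ν)).eq]
    change X * P = _
    rw [hXP, add_mul, mul_add, hPτ.eq, smul_mul_assoc, mul_smul_comm, one_mul, mul_one]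
  calc τ k * (P * A * P) - P * A * P * τ k
      = (τ k * P) * A * P - P * A * (P * τ k) := by simp only [mul_assoc]
    _ = P * τ k * A * P - P * A * (τ k * P) := by rw [hPτ.eq]
    _ = P * (τ k + r ν k • 1) * A * P - P * A * ((τ k + r ν k • 1) * P) := by
        simp only [mul_add, add_mul, smul_mul_assoc, mul_smul_comm, one_mul, mul_one]
        abel
    _ = P * X * A * P - P * A * (X * P) := by rw [hPX, hXP]
    _ = _ := by noncomm_ring

end Rearrange

/-- Finitely many points can be placed injectively on a grid. -/
theorem exists_injOn_grid {α : Type*} (J : Finset α) {L : ℕ} (h : J.card ≤ L ^ n) :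
    ∃ z : α → Fin n → ℕ, Set.InjOn z J ∧ ∀ ν ∈ J, ∀ k, 1 ≤ z ν k ∧ z ν k ≤ L := by
  classical
  have : Fintype.card J ≤ Fintype.card (Fin n → Fin L) := by simpa using h
  obtain ⟨e⟩ := Function.Embedding.nonempty_of_card_le this
  -- Grid coordinates start at 1, so that the value 0, taken by the rearranged tuple off all blocks,
  -- stays separated from the blocks.
  refine ⟨fun ν k => if hν : ν ∈ J then (e ⟨ν, hν⟩ k : ℕ) + 1 else 0, fun ν hν ν' hν' h => ?_,
    fun ν hν k => ?_⟩
  · rw [Finset.mem_coe] at hν hν'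
    have : e ⟨ν, hν⟩ = e ⟨ν', hν'⟩ := by
      ext k
      have := congrFun h k
      simpa [hν, hν'] using this
    simpa using e.injective this
  · have := (e ⟨ν, hν⟩ k).2
    simp only [hν, dif_pos]
    omega

/-- Spectral projections of the blocks leave invariant the cyclic subspaces of a rearranged tuple
whose blocks are separated. -/
theorem commute_proj_block {X : Fin n → H →L[ℂ] H} {g : Fin n → (Fin n → ℝ) → ℝ}
    (hX : ∀ k, E.Represents (X k) (g k)) {α : Type*} {J : Finset α} {B : α → Set (Fin n → ℝ)}
    (hB : ∀ a, MeasurableSet (B a)) (hd : (J : Set α).PairwiseDisjoint B)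
    {z : α → Fin n → ℕ} (hz : Set.InjOn z J) (hz1 : ∀ ν ∈ J, ∀ k, 1 ≤ z ν k) {ε : ℝ} (hε : 0 < ε)
    (hg : ∀ ν ∈ J, ∀ y ∈ B ν, ∀ k, 2 * z ν k * ε ≤ g k y ∧ g k y ≤ (2 * z ν k + 1) * ε)
    (hg0 : ∀ y, (∀ ν ∈ J, y ∉ B ν) → ∀ k, g k y = 0) {P : H →L[ℂ] H} (hP : IsSelfAdjoint P)
    (hPX : ∀ k, Commute (X k) P) [NeZero n] {ν : α} (hν : ν ∈ J) :
    Commute P (E.proj (B ν)) := by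
  classical
  -- The blocks whose `k`-th grid coordinate exceeds `l`. On them `g k ≥ (2 * l + 2) * ε`, and
  -- elsewhere `g k ≤ (2 * l + 1) * ε`, so the gap makes the projection of the complement a spectral
  -- projection of `X k`.
  let U : Fin n → ℕ → Set (Fin n → ℝ) := fun k l => ⋃ ν ∈ J.filter (fun ν => l < z ν k), B ν
  have hU : ∀ k l, MeasurableSet (U k l) := fun k l => Finset.measurableSet_biUnion _ fun a _ => hB a
  have hUmem : ∀ k l y, y ∈ U k l ↔ ∃ ν ∈ J, l < z ν k ∧ y ∈ B ν := fun k l y => by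
    simp [U, and_assoc]
  have hcc : ∀ k l, Commute P (E.proj (U k l)ᶜ) := by
    intro k l
    have h := ProjectionMeasure.lowerProjection_eq_proj (hX k) (hU k l).compl
      (t := (2 * l + 1) * ε) hε (fun y hy => ?_) (fun y hy => ?_)
    · rw [← h]
      exact (commute_lowerProjection (hX k).isSelfAdjoint _ hP (hPX k)).symm
    · rw [Set.mem_compl_iff, hUmem] at hy
      push Not at hy
      by_cases hyJ : ∃ ν ∈ J, y ∈ B ν
      · obtain ⟨ν, hν, hyν⟩ := hyJ
        have h1 : z ν k ≤ l := by
          by_contra! hlt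
          exact hy ν hν hlt hyν
        refine (hg ν hν y hyν k).2.trans ?_
        gcongr
      · push Not at hyJ
        rw [hg0 y hyJ k]
        positivity
    · rw [Set.notMem_compl_iff, hUmem] at hy
      obtain ⟨ν, hν, hlt, hyν⟩ := hy
      refine le_trans ?_ (hg ν hν y hyν k).1
      have h1 : ((l : ℝ) + 1) ≤ z ν k := by exact_mod_cast hlt
      nlinarith
  have hc : ∀ k l, Commute P (E.proj (U k l)) := by
    intro k l
    have h1 := ProjectionMeasure.proj_compl (E := E) (hU k l)
    have h2 : E.proj (U k l) = 1 - E.proj (U k l)ᶜ := by rw [h1, sub_sub_cancel]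
    rw [h2]
    exact (Commute.one_right P).sub_right (hcc k l)
  -- A block is singled out by its grid coordinates because `z` is injective. At least one
  -- coordinate is needed, since an empty intersection is the whole space.
  have hBν : B ν = ⋂ k, (U k (z ν k - 1) ∩ (U k (z ν k))ᶜ) := by
    ext y
    simp only [Set.mem_iInter, Set.mem_inter_iff, Set.mem_compl_iff, hUmem]
    constructor
    · intro hy k
      refine ⟨⟨ν, hν, ?_, hy⟩, ?_⟩
      · have := hz1 ν hν k
        omega
      · rintro ⟨ν', hν', hlt, hy'⟩
        have : ν' = ν := by
          by_contra hne
          exact Set.disjoint_left.1 (hd hν' hν hne) hy' hy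
        subst this
        exact lt_irrefl _ hlt
    · intro hy
      obtain ⟨⟨ν', hν', -, hy'⟩, -⟩ := hy 0
      have : ν' = ν := by
        refine hz hν' hν (funext fun k => ?_)
        obtain ⟨⟨ν'', hν'', hlt, hy''⟩, hnot⟩ := hy k
        have h1 : ν'' = ν' := by
          by_contra hne
          exact Set.disjoint_left.1 (hd hν'' hν' hne) hy'' hy'
        subst h1
        have h2 : ¬ z ν k < z ν'' k := fun h => hnot ⟨ν'', hν'', h, hy''⟩
        have := hz1 ν hν k
        omega
      exact this ▸ hy'
  rw [hBν]
  refine ProjectionMeasure.commute_proj_iInter (fun k => (hU k _).inter (hU k _).compl) fun k => ?_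
  rw [E.proj_inter _ _ (hU k _) (hU k _).compl]
  exact (hc k _).mul_right (hcc k _)

open BoxIntegral in
-- Fewer than a fixed small proportion of the unit volume's cubes suffice to carry `v`, so they fit
-- into a grid of diameter `O(η)` even with gaps between them. The cyclic bound for the rearranged
-- tuple then tends to zero with `η`.
theorem quasicentralModulus_eq_zero_of_singular [TopologicalSpace.SeparableSpace H]
    {φ : Fin n → NormingFunction} {C : ℝ≥0} (hC : HasCyclicBound.{u} φ C)
    {τ : Fin n → H →L[ℂ] H} (hτ : IsCommutingHermitian τ) (hE : E.IsSpectralMeasureOf τ)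
    (hs : E.IsLebesgueSingular) : quasicentralModulus φ τ = 0 := by
  refine quasicentralModulus_eq_zero φ τ fun v δ hδ => ?_
  -- For `n = 0` there are no commutators, and the projection onto the line of `v` suffices.
  rcases Nat.eq_zero_or_pos n with rfl | hn
  · refine ⟨_, isPosContraction_starProjection (Submodule.span ℂ {v}), ?_, fun j => j.elim0⟩
    have : (Submodule.span ℂ {v}).starProjection v = v :=
      Submodule.starProjection_eq_self_iff.2 (Submodule.mem_span_singleton_self v)
    simpa [this] using hδ.le
  have : NeZero n := ⟨hn.ne'⟩
  obtain ⟨N, hNm, hN0, hEN⟩ := hs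
  -- Chosen so that `81 * (η * (5 * C + 1)) = δ`: extension from the cyclic subspace and pinching
  -- each cost 9, and `η * (5 * C + 1)` exceeds `C * ‖X‖`.
  set η : ℝ := δ / (81 * (5 * C + 1))
  have hη : 0 < η := by positivity
  obtain ⟨p, ⟨hp1, hp2⟩, hp3⟩ := (((ProjectionMeasure.exists_cubes hN0 hEN hNm v hη hδ).and
    (eventually_ge_atTop ⌈1 / η⌉₊)).and (eventually_gt_atTop 0)).exists
  have hpne : NeZero p := ⟨hp3.ne'⟩
  have hp0 : (0 : ℝ) < p := by exact_mod_cast hp3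
  have hpη : 1 / η ≤ p := (Nat.le_ceil _).trans (by exact_mod_cast hp2)
  have hpη' : 1 ≤ η * p := by
    rwa [div_le_iff₀ hη, mul_comm] at hpη
  obtain ⟨J, hJc, hJv⟩ := hp1 hpne
  set L : ℕ := ⌈η * p⌉₊
  have hL1 : η * p ≤ L := Nat.le_ceil _
  have hL2 : (L : ℝ) < η * p + 1 := Nat.ceil_lt_add_one (by positivity)
  obtain ⟨z, hzinj, hz⟩ := exists_injOn_grid (n := n) J (L := L) (by
    have : (J.card : ℝ) ≤ (L : ℝ) ^ n := hJc.trans (by gcongr)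
    exact_mod_cast this)
  let B : (Fin n → ℤ) → Set (Fin n → ℝ) := fun ν => unitPartition.box p ν
  have hB : ∀ ν, MeasurableSet (B ν) := fun ν => (unitPartition.box p ν).measurableSet_coe
  have hd : (J : Set (Fin n → ℤ)).PairwiseDisjoint B := fun ν _ ν' _ h =>
    unitPartition.disjoint.1 h
  -- The lower corner `ν / p` of a cube moves to `2 * z ν / p`. The factor 2 leaves gaps of width `1
  -- / p` between distinct coordinate slabs.
  let r : (Fin n → ℤ) → Fin n → ℝ := fun ν k => 2 * z ν k * (p : ℝ)⁻¹ - ν k / p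
  let X := E.rearrange τ J B r
  let g : Fin n → (Fin n → ℝ) → ℝ := fun k => ∑ ν ∈ J, (B ν).indicator ((fun y => y k) + r ν k • 1)
  have hXg : ∀ k, E.Represents (X k) (g k) := fun k =>
    ProjectionMeasure.represents_rearrange hE hB k
  have hX : IsCommutingHermitian X := ProjectionMeasure.isCommutingHermitian_rearrange hE hB hτ
  have hg : ∀ ν ∈ J, ∀ y ∈ B ν, ∀ k,
      2 * z ν k * (p : ℝ)⁻¹ ≤ g k y ∧ g k y ≤ (2 * z ν k + 1) * (p : ℝ)⁻¹ := by
    intro ν hν y hy k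
    have h1 : g k y = y k + r ν k := by
      simp only [g, Finset.sum_apply]
      rw [Finset.sum_eq_single_of_mem ν hν]
      · simp [hy]
      · intro ν' hν' hne
        exact Set.indicator_of_notMem (fun hy' => Set.disjoint_left.1 (hd hν' hν hne) hy' hy) _
    have h2 : (ν k : ℝ) / p < y k ∧ y k ≤ (ν k + 1) / p := unitPartition.mem_box_iff.1 hy k
    rw [add_div, one_div] at h2
    rw [h1]
    simp only [r]
    constructor <;> linarith
  have hg0 : ∀ y, (∀ ν ∈ J, y ∉ B ν) → ∀ k, g k y = 0 := by
    intro y hy k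
    simp only [g, Finset.sum_apply]
    exact Finset.sum_eq_zero fun ν hν => Set.indicator_of_notMem (hy ν hν) _
  -- The values are at most `(2 * L + 1) / p`, with `L < η * p + 1` and `1 ≤ η * p`.
  have hXn : ‖X‖ ≤ 5 * η := by
    refine (pi_norm_le_iff_of_nonneg (by positivity)).2 fun k =>
      (hXg k).norm_le (by positivity) fun y => ?_
    by_cases hyJ : ∃ ν ∈ J, y ∈ B ν
    · obtain ⟨ν, hν, hyν⟩ := hyJ
      obtain ⟨h1, h2⟩ := hg ν hν y hyν k
      rw [abs_of_nonneg (le_trans (by positivity) h1)]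
      refine h2.trans ?_
      have h3 : (z ν k : ℝ) ≤ L := by exact_mod_cast (hz ν hν k).2
      rw [← div_eq_mul_inv, div_le_iff₀ hp0]
      nlinarith
    · push Not at hyJ
      rw [hg0 y hyJ k, abs_zero]
      positivity
  set w : H := ∑ ν ∈ J, E.proj (B ν) v
  set K := cyclicSubspace X w
  have hPB : ∀ ν ∈ J, Commute K.starProjection (E.proj (B ν)) := fun ν hν =>
    commute_proj_block hXg hB hd hzinj (fun ν hν k => (hz ν hν k).1) (inv_pos.2 hp0) hg hg0
      (isSelfAdjoint_starProjection K)
      (fun k => (commute_cyclicSubspace_starProjection hX w k).symm) hν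
  have hBw : ∀ ν ∈ J, E.proj (B ν) w ∈ K := by
    intro ν hν
    rw [← K.starProjection_eq_self_iff]
    have h1 := DFunLike.congr_fun (hPB ν hν).eq w
    have h2 : K.starProjection w = w :=
      K.starProjection_eq_self_iff.2 (self_mem_cyclicSubspace X w)
    rw [mul_apply_eq_comp, mul_apply_eq_comp, h2] at h1
    exact h1
  classical
  let S : Finset H := J.image fun ν => E.proj (B ν) w
  have hSK : Submodule.span ℂ (S : Set H) ≤ K := by
    rw [Submodule.span_le]
    intro x hx
    obtain ⟨ν, hν, rfl⟩ := Finset.mem_image.1 (Finset.mem_coe.1 hx)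
    exact hBw ν hν
  have hc : 0 < η * (5 * C + 1) := by positivity
  obtain ⟨A, hA, hAW, hAc⟩ := exists_posContraction_cyclicSubspace hC hX w hc (by
    have : (C : ℝ) * ‖X‖ ≤ C * (5 * η) := by gcongr
    nlinarith) hSK
  have hη' : 81 * (η * (5 * C + 1)) = δ := by
    simp only [η]
    field_simp
  -- Since `A` fixes every component of `w` in a block, its block diagonal part fixes `w`, and the
  -- error on `v` is at most `‖v - w‖`.
  have hA' := E.isPosContraction_pinch J hB hd hA
  refine ⟨_, hA', ?_, fun k => ?_⟩
  · set A' := ∑ ν ∈ J, E.proj (B ν) * A * E.proj (B ν)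
    have hproj : ∀ ν ∈ J, E.proj (B ν) w = E.proj (B ν) v := by
      intro ν hν
      simp only [w]
      rw [map_sum, Finset.sum_eq_single_of_mem ν hν]
      · exact DFunLike.congr_fun (E.proj_mul_self (hB ν)) v
      · intro ν' hν' hne
        have : E.proj (B ν) * E.proj (B ν') = 0 := by
          rw [← E.proj_inter _ _ (hB ν) (hB ν'), (hd hν hν' hne.symm).inter_eq, E.proj_empty]
        exact DFunLike.congr_fun this v
    have hA'w : A' w = w := by
      simp only [A', sum_apply]
      refine Finset.sum_congr rfl fun ν hν => ?_
      have h1 : A (E.proj (B ν) w) = E.proj (B ν) w :=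
        hAW _ (Submodule.subset_span (Finset.mem_coe.2 (Finset.mem_image_of_mem _ hν)))
      rw [mul_apply_eq_comp, mul_apply_eq_comp, h1, ← hproj ν hν]
      exact DFunLike.congr_fun (E.proj_mul_self (hB ν)) w
    have h1 : (1 - A') v = (1 - A') (v - w) := by
      simp [hA'w]
    rw [h1]
    calc _ ≤ 1 * ‖v - w‖ := ContinuousLinearMap.le_of_opNorm_le _ hA'.norm_one_sub_le _
      _ ≤ δ := by rw [one_mul]; exact hJv
  · rw [ProjectionMeasure.commutator_pinch (r := r) hE hB hd A k]
    refine (E.gauge_pinch_le (φ k) J hB hd (hA.finiteRank.commutator (X k))).trans ?_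
    have := hAc k
    linarith

end Singular

theorem mainTheorem8 {n : ℕ} (φ : Fin n → NormingFunction) :
    ((∀ k, Tendsto (fun m : ℕ => φ k (onesSeq m)) atTop atTop) →
      ∀ B : ℝ, 0 < B →
      Tendsto (fun m : ℕ => (m : ℝ)⁻¹ * ∏ k, φ k (onesSeq m)) atTop (𝓝 B) →
      ∃ C : ℝ≥0, HasCyclicBound.{u} φ C) ∧
    ((∃ C : ℝ≥0, HasCyclicBound.{u} φ C) →
      ∀ (H : Type u) [NormedAddCommGroup H] [InnerProductSpace ℂ H] [CompleteSpace H]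
        [TopologicalSpace.SeparableSpace H], ¬ FiniteDimensional ℂ H →
        ∀ τ : Fin n → H →L[ℂ] H, IsCommutingHermitian τ →
        (∃ E : ProjectionMeasure H n, E.IsSpectralMeasureOf τ ∧ E.IsLebesgueSingular) →
        quasicentralModulus φ τ = 0) := by
  refine ⟨fun h B hB hlim => hasCyclicBound_of_tendsto φ h hB hlim, ?_⟩
  rintro ⟨C, hC⟩ H _ _ _ _ _ τ hτ ⟨E, hE, hs⟩
  exact quasicentralModulus_eq_zero_of_singular hC hτ hE hs
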